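/- Let $G$ be a compact connected Lie group with Lie algebra $\mathfrak g$ and write $S^1=\mathbb R/2\pi\mathbb Z$. Let $\Omega G$ be the group of smooth maps $\gamma\colon S^1\to G$ with $\gamma(0)=1$, let $L\mathfrak g$ be the space of smooth maps $S^1\to\mathfrak g$, and let $PG$ be the space of smooth maps $g\colon\mathbb R\to G$ with $g(0)=1$ and $g^{-1}\partial g$ $2\pi$-periodic. $\Omega G$ acts on $PG$ from the right by pointwise multiplication; the path fibration is $PG\to G$, $g\mapsto g(2\pi)$. These spaces carry their usual smooth structures, in which a finite-dimensional family $x\mapsto c_x$ is smooth iff $(x,t)\mapsto c_x(t)$ is smooth; smoothness of maps is understood diffeologically (smooth finite-dimensional families go to smooth finite-dimensional families), which for maps between finite-dimensional or Fréchet manifolds is the usual notion. Let $\pi\colon P\to M$ be a smooth, locally trivial principal right $\Omega G$-bundle, where $M$ may be a finite-dimensional or Fréchet manifold or any diffeological space. Let $\Phi$ be a Higgs field for $P$, that is, a smooth map $\Phi\colon P\to L\mathfrak g$ with $$\Phi(p\gamma)=\mathrm{ad}(\gamma^{-1})\Phi(p)+\gamma^{-1}\partial\gamma\qquad(p\in P,\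 \gamma\in\Omega G).$$ Then for every $p\in P$ the equation $g^{-1}\partial g=\Phi(p)$ has exactly one solution $g\in PG$, denoted $\mathrm{hol}_\Phi(p)$. The map $\mathrm{hol}_\Phi\colon P\to PG$ is smooth and satisfies $\mathrm{hol}_\Phi(p\gamma)=\mathrm{hol}_\Phi(p)\gamma$, so it descends to a map $\mathrm{hol}_\Phi\colon M\to G$, $\pi(p)\mapsto \mathrm{hol}_\Phi(p)(2\pi)$. This map is a classifying map for $P$: it is smooth, and $P$ is isomorphic, as a smooth $\Omega G$-bundle over $M$, to the pullback of the path fibration $PG\to G$ along $\mathrm{hol}_\Phi\colon M\to G$. -/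

import Mathlib

open scoped Manifold ContDiff RightActions Topology
open Diffeology

/-! ## Diffeologies

Smoothness on the (infinite-dimensional) loop and path spaces, on the bundles and on their bases is
smoothness in the sense of diffeology: a map is smooth when it carries smooth finite-dimensional
families (plots) to smooth finite-dimensional families. -/

/-- The diffeology of a smooth manifold: the plots are the smooth maps `ℝⁿ → N`. -/
@[reducible]
noncomputable def manifoldDiffeology {E H : Type*} [NormedAddCommGroup E] [NormedSpace ℝ E]
    [TopologicalSpace H] (I : ModelWithCorners ℝ E H) (N : Type*) [TopologicalSpace N]
    [ChartedSpace H N] : DiffeologicalSpace N :=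
  .ofCorePlotsOn {
    isPlotOn := fun {n u} _ p ↦ ContMDiffOn 𝓘(ℝ, EuclideanSpace ℝ (Fin n)) I ∞ p u
    isPlotOn_congr := fun _ _ _ h ↦ contMDiffOn_congr h
    isPlot_const := fun _ ↦ contMDiffOn_const
    isPlotOn_reparam := fun _ _ _ h hp hf ↦ hp.comp hf.contMDiffOn h.subset_preimage
    locality := fun _ _ h x hxu ↦ by
      obtain ⟨v, hv, hxv, hv'⟩ := h x hxu
      exact (hv'.contMDiffAt (hv.mem_nhds hxv)).contMDiffWithinAt }

/-- The functional diffeology on a space `X` of maps `ℝ → N` (given by the evaluation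
`ev : X → ℝ → N`): a family `x ↦ c x` is a plot iff `(x, t) ↦ ev (c x) t` is jointly smooth. -/
@[reducible]
noncomputable def functionalDiffeology {E H : Type*} [NormedAddCommGroup E] [NormedSpace ℝ E]
    [TopologicalSpace H] (I : ModelWithCorners ℝ E H) {N : Type*} [TopologicalSpace N]
    [ChartedSpace H N] {X : Type*} (ev : X → ℝ → N)
    (hev : ∀ x, ContMDiff 𝓘(ℝ, ℝ) I ∞ (ev x)) : DiffeologicalSpace X :=
  .ofCorePlotsOn {
    isPlotOn := fun {n u} _ c ↦
      ContMDiffOn (𝓘(ℝ, EuclideanSpace ℝ (Fin n)).prod 𝓘(ℝ, ℝ)) I ∞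
        (fun z : EuclideanSpace ℝ (Fin n) × ℝ ↦ ev (c z.1) z.2) (u ×ˢ Set.univ)
    isPlotOn_congr := fun _ _ _ h ↦ contMDiffOn_congr fun z hz ↦ by rw [h hz.1]
    isPlot_const := fun x ↦ ((hev x).comp contMDiff_snd).contMDiffOn
    isPlotOn_reparam := fun {n m u v hu} hv {p f} h hp hf ↦ by
      have hg : ContMDiffOn (𝓘(ℝ, EuclideanSpace ℝ (Fin m)).prod 𝓘(ℝ, ℝ))
          (𝓘(ℝ, EuclideanSpace ℝ (Fin n)).prod 𝓘(ℝ, ℝ)) ∞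
          (Prod.map f (id : ℝ → ℝ)) (v ×ˢ Set.univ) :=
        hf.contMDiffOn.prodMap contMDiffOn_id
      exact hp.comp hg fun z hz ↦ ⟨h hz.1, trivial⟩
    locality := fun _ _ h z hz ↦ by
      obtain ⟨v, hv, hxv, hv'⟩ := h z.1 hz.1
      exact (hv'.contMDiffAt
        ((hv.prod isOpen_univ).mem_nhds ⟨hxv, trivial⟩)).contMDiffWithinAt }

/-- The subspace diffeology. -/
instance Subtype.instDiffeologicalSpace {X : Type*} [DiffeologicalSpace X] {s : X → Prop} :
    DiffeologicalSpace (Subtype s) where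
  plots n := {c | IsPlot (fun x ↦ (c x : X))}
  constant_plots x := isPlot_const
  plot_reparam hp hf := isPlot_reparam hp hf
  locality hp := DiffeologicalSpace.locality hp

/-- The product diffeology. -/
instance Prod.instDiffeologicalSpace {X Y : Type*} [DiffeologicalSpace X] [DiffeologicalSpace Y] :
    DiffeologicalSpace (X × Y) where
  plots n := {c | IsPlot (fun x ↦ (c x).1) ∧ IsPlot (fun x ↦ (c x).2)}
  constant_plots x := ⟨isPlot_const, isPlot_const⟩
  plot_reparam hp hf := ⟨isPlot_reparam hp.1 hf, isPlot_reparam hp.2 hf⟩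
  locality hp := by
    refine ⟨DiffeologicalSpace.locality fun x ↦ ?_, DiffeologicalSpace.locality fun x ↦ ?_⟩ <;>
    · obtain ⟨u, hu, hx, h⟩ := hp x
      refine ⟨u, hu, hx, fun hf hf' ↦ ?_⟩
      first
        | exact (h hf hf').1
        | exact (h hf hf').2

/-! ## Smooth principal bundles -/

/-- `π : P → M` is a smooth (locally trivial) principal right `Γ`-bundle: `Γ` acts smoothly on `P`
from the right, `π` is smooth, and every point of `M` has an open neighbourhood `U` with a
`Γ`-equivariant diffeomorphism `U × Γ ≃ π ⁻¹ U` over `U`. -/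
structure IsPrincipalBundle (Γ : Type*) [Group Γ] [DiffeologicalSpace Γ] {P M : Type*}
    [DiffeologicalSpace P] [DiffeologicalSpace M] [MulAction Γᵐᵒᵖ P] (π : P → M) : Prop where
  smooth_proj : DSmooth π
  smooth_act : DSmooth (fun x : P × Γ ↦ x.1 <• x.2)
  locally_trivial : ∀ m : M, ∃ U : Set M, IsOpen[dTopology] U ∧ m ∈ U ∧
    ∃ e : (U × Γ) ≃ (π ⁻¹' U), DSmooth e ∧ DSmooth e.symm ∧
      (∀ (u : U) (γ : Γ), π (e (u, γ)) = u) ∧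
      (∀ (u : U) (γ δ : Γ), (e (u, γ * δ) : P) = (e (u, γ) : P) <• δ)

/-- The `Γ`-bundle `π : P → M` is (isomorphic to) the pullback `f^* Q` of `ϖ : Q → B` along
`f : M → B`. Here `f^* Q = {(m, q) | f m = ϖ q}` with projection `(m, q) ↦ m` and
`Γ` acting on the second component, and an isomorphism is a `Γ`-equivariant diffeomorphism
covering the identity of `M`. -/
def IsPullbackBundle (Γ : Type*) [Group Γ] {P M Q B : Type*} [DiffeologicalSpace P]
    [DiffeologicalSpace M] [DiffeologicalSpace Q] [MulAction Γᵐᵒᵖ P] [MulAction Γᵐᵒᵖ Q]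
    (π : P → M) (ϖ : Q → B) (f : M → B) : Prop :=
  ∃ e : P ≃ {x : M × Q // f x.1 = ϖ x.2}, DSmooth e ∧ DSmooth e.symm ∧
    (∀ p, (e p).1.1 = π p) ∧ (∀ (p : P) (γ : Γ), (e (p <• γ)).1.2 = (e p).1.2 <• γ)

/-! ## Loops and paths in a Lie group -/

section LieGroup

variable {E H : Type*} [NormedAddCommGroup E] [NormedSpace ℝ E] [TopologicalSpace H]
  (I : ModelWithCorners ℝ E H) {G : Type*} [TopologicalSpace G] [ChartedSpace H G] [Group G]

/-- `(g⁻¹ ∂g)(t)`: the derivative `g'(t)`, a tangent vector at `g t`, moved to the identity by left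
translation with `(g t)⁻¹`. -/
noncomputable def leftLogDeriv (g : ℝ → G) (t : ℝ) : GroupLieAlgebra I G :=
  show E from mfderiv I I (fun x ↦ (g t)⁻¹ * x) (g t) (mfderiv 𝓘(ℝ, ℝ) I g t (1 : ℝ))

/-- The adjoint action of `a` on the Lie algebra: the derivative at `1` of `x ↦ a * x * a⁻¹`. -/
noncomputable def lieAd (a : G) (v : GroupLieAlgebra I G) : GroupLieAlgebra I G :=
  show E from mfderiv I I (fun x ↦ a * x * a⁻¹) (1 : G) v

variable (G)

/-- Smooth maps `ℝ / 2πℤ → G` taking the value `1` at `0`, as a subgroup of the group of all maps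
`ℝ → G` under pointwise multiplication. -/
def loopSubgroup [LieGroup I ∞ G] : Subgroup (ℝ → G) where
  carrier := {γ | ContMDiff 𝓘(ℝ, ℝ) I ∞ γ ∧ Function.Periodic γ (2 * Real.pi) ∧ γ 0 = 1}
  mul_mem' {a b} ha hb := ⟨ha.1.mul hb.1, ha.2.1.mul hb.2.1, by simp [ha.2.2, hb.2.2]⟩
  one_mem' := ⟨contMDiff_const, fun _ ↦ rfl, rfl⟩
  inv_mem' {a} ha := ⟨ha.1.inv, fun t ↦ by simp [ha.2.1 t], by simp [ha.2.2]⟩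

/-- The based loop group `ΩG`. -/
def LoopGroup [LieGroup I ∞ G] : Type _ := ↥(loopSubgroup I G)

/-- The path space `PG`: smooth maps `g : ℝ → G` with `g 0 = 1` and `g⁻¹ ∂g` periodic. -/
@[ext]
structure PathSpace where
  toFun : ℝ → G
  smooth : ContMDiff 𝓘(ℝ, ℝ) I ∞ toFun
  map_zero : toFun 0 = 1
  periodic : Function.Periodic (leftLogDeriv I toFun) (2 * Real.pi)

/-- Smooth maps from `ℝ / 2πℤ` to the Lie algebra of `G`. -/
structure LoopAlgebra where
  toFun : ℝ → GroupLieAlgebra I G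
  smooth : ContDiff ℝ ∞ (show ℝ → E from toFun)
  periodic : Function.Periodic toFun (2 * Real.pi)

noncomputable instance [LieGroup I ∞ G] : Group (LoopGroup I G) :=
  inferInstanceAs (Group ↥(loopSubgroup I G))

instance [LieGroup I ∞ G] : CoeFun (LoopGroup I G) (fun _ ↦ ℝ → G) := ⟨Subtype.val⟩

instance : CoeFun (PathSpace I G) (fun _ ↦ ℝ → G) := ⟨PathSpace.toFun⟩

instance : CoeFun (LoopAlgebra I G) (fun _ ↦ ℝ → GroupLieAlgebra I G) := ⟨LoopAlgebra.toFun⟩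

noncomputable instance [LieGroup I ∞ G] : DiffeologicalSpace (LoopGroup I G) :=
  functionalDiffeology I (fun γ : LoopGroup I G ↦ (γ : ℝ → G)) (fun γ ↦ γ.2.1)

noncomputable instance : DiffeologicalSpace (PathSpace I G) :=
  functionalDiffeology I (fun g : PathSpace I G ↦ (g : ℝ → G)) (fun g ↦ g.smooth)

noncomputable instance : DiffeologicalSpace (LoopAlgebra I G) :=
  functionalDiffeology 𝓘(ℝ, E) (fun (ξ : LoopAlgebra I G) (t : ℝ) ↦ (show E from ξ t))
    (fun ξ ↦ ξ.smooth.contMDiff)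

variable {G}

/-- The product rule `(gγ)⁻¹ ∂(gγ) = ad (γ⁻¹) (g⁻¹ ∂g) + γ⁻¹ ∂γ`. -/
theorem leftLogDeriv_mul [LieGroup I ∞ G] {g γ : ℝ → G}
    (hg : ContMDiff 𝓘(ℝ, ℝ) I ∞ g) (hγ : ContMDiff 𝓘(ℝ, ℝ) I ∞ γ) (t : ℝ) :
    leftLogDeriv I (g * γ) t =
      lieAd I (γ t)⁻¹ (leftLogDeriv I g t) + leftLogDeriv I γ t := by
  have hL : ∀ a : G, MDifferentiable I I (fun x ↦ a * x) := fun a ↦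
    (contMDiff_mul_left (I := I) (n := ∞) (a := a)).mdifferentiable (by simp)
  have hR : ∀ a : G, MDifferentiable I I (fun x ↦ x * a) := fun a ↦
    (contMDiff_mul_right (I := I) (n := ∞) (a := a)).mdifferentiable (by simp)
  have hg' : MDifferentiableAt 𝓘(ℝ, ℝ) I g t := hg.mdifferentiable (by simp) t
  have hγ' : MDifferentiableAt 𝓘(ℝ, ℝ) I γ t := hγ.mdifferentiable (by simp) t
  have hμ : MDifferentiableAt (I.prod I) I (fun x : G × G ↦ x.1 * x.2) (g t, γ t) :=
    (contMDiff_mul I ∞).mdifferentiable (by simp) _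
  set a := (g t * γ t)⁻¹ with ha
  have h1 : (mfderiv 𝓘(ℝ, ℝ) I (g * γ) t (1 : ℝ) : E) =
      (mfderiv I I (fun x ↦ x * γ t) (g t) (mfderiv 𝓘(ℝ, ℝ) I g t (1 : ℝ)) : E) +
      (mfderiv I I (fun x ↦ g t * x) (γ t) (mfderiv 𝓘(ℝ, ℝ) I γ t (1 : ℝ)) : E) := by
    have hc := mfderiv_comp_apply (I := 𝓘(ℝ, ℝ)) (I' := I.prod I) (I'' := I) t
      (f := fun s ↦ (g s, γ s)) hμ (hg'.prodMk hγ') (1 : ℝ)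
    rw [mfderiv_prod_eq_add_apply hμ, mfderiv_prodMk hg' hγ'] at hc
    exact hc
  have h2 : (mfderiv I I (fun x ↦ a * x) (g t * γ t)
        (mfderiv I I (fun x ↦ x * γ t) (g t) (mfderiv 𝓘(ℝ, ℝ) I g t (1 : ℝ))) : E) =
      (mfderiv I I (fun x ↦ a * (x * γ t)) (g t) (mfderiv 𝓘(ℝ, ℝ) I g t (1 : ℝ)) : E) :=
    (mfderiv_comp_apply (I := I) (I' := I) (I'' := I) (g t) (f := fun x ↦ x * γ t)
      (g := fun x ↦ a * x) (hL a _) (hR (γ t) _) _).symm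
  have h3 : (mfderiv I I (fun x ↦ a * x) (g t * γ t)
        (mfderiv I I (fun x ↦ g t * x) (γ t) (mfderiv 𝓘(ℝ, ℝ) I γ t (1 : ℝ))) : E) =
      (mfderiv I I (fun x ↦ a * (g t * x)) (γ t) (mfderiv 𝓘(ℝ, ℝ) I γ t (1 : ℝ)) : E) :=
    (mfderiv_comp_apply (I := I) (I' := I) (I'' := I) (γ t) (f := fun x ↦ g t * x)
      (g := fun x ↦ a * x) (hL a _) (hL (g t) _) _).symm
  have hC : MDifferentiable I I (fun x : G ↦ (γ t)⁻¹ * x * ((γ t)⁻¹)⁻¹) := fun x ↦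
    MDifferentiableAt.comp (I' := I) x (hR _ _) (hL _ _)
  have h4 : (lieAd I (γ t)⁻¹ (leftLogDeriv I g t) : E) =
      (mfderiv I I (fun x ↦ a * (x * γ t)) (g t) (mfderiv 𝓘(ℝ, ℝ) I g t (1 : ℝ)) : E) := by
    have hone : ∀ (y : G) (v : E), y = 1 →
        (mfderiv I I (fun x : G ↦ (γ t)⁻¹ * x * ((γ t)⁻¹)⁻¹) (1 : G) v : E) =
        (mfderiv I I (fun x : G ↦ (γ t)⁻¹ * x * ((γ t)⁻¹)⁻¹) y v : E) := by
      rintro y v rfl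
      rfl
    have hc := mfderiv_comp_apply (I := I) (I' := I) (I'' := I) (g t)
      (f := fun x ↦ (g t)⁻¹ * x) (g := fun x : G ↦ (γ t)⁻¹ * x * ((γ t)⁻¹)⁻¹)
      (hC _) (hL (g t)⁻¹ _) (mfderiv 𝓘(ℝ, ℝ) I g t (1 : ℝ))
    have hfun : (fun x : G ↦ (γ t)⁻¹ * x * ((γ t)⁻¹)⁻¹) ∘ (fun x ↦ (g t)⁻¹ * x) =
        fun x ↦ a * (x * γ t) := by
      funext x
      simp [ha, mul_assoc]
    rw [hfun] at hc
    exact (hone _ _ (inv_mul_cancel (g t))).trans hc.symm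
  have h5 : (leftLogDeriv I γ t : E) =
      (mfderiv I I (fun x ↦ a * (g t * x)) (γ t) (mfderiv 𝓘(ℝ, ℝ) I γ t (1 : ℝ)) : E) := by
    have hfun : (fun x ↦ a * (g t * x)) = fun x ↦ (γ t)⁻¹ * x := by
      funext x
      simp [ha, mul_assoc]
    rw [hfun]
    rfl
  change (mfderiv I I (fun x ↦ a * x) (g t * γ t)
    (mfderiv 𝓘(ℝ, ℝ) I (g * γ) t (1 : ℝ)) : E) =
    (lieAd I (γ t)⁻¹ (leftLogDeriv I g t) : E) + (leftLogDeriv I γ t : E)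
  rw [h4, h5, ← h2, ← h3]
  refine (congrArg (fun v : E ↦ (mfderiv I I (fun x ↦ a * x) (g t * γ t) v : E)) h1).trans ?_
  exact map_add (mfderiv I I (fun x ↦ a * x) (g t * γ t)) _ _

theorem leftLogDeriv_periodic {γ : ℝ → G} (hγ : ContMDiff 𝓘(ℝ, ℝ) I ∞ γ) {T : ℝ}
    (hγT : Function.Periodic γ T) : Function.Periodic (leftLogDeriv I γ) T := by
  intro t
  have key : ∀ (γ' : ℝ → G), γ' = γ → leftLogDeriv I γ' t = leftLogDeriv I γ t := by
    rintro _ rfl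
    rfl
  rw [← key (fun s ↦ γ (s + T)) (funext hγT)]
  have hc := mfderiv_comp_apply (I := 𝓘(ℝ, ℝ)) (I' := 𝓘(ℝ, ℝ)) (I'' := I) t
    (f := fun s : ℝ ↦ s + T) (g := γ) (hγ.mdifferentiable (by simp) _)
    (by exact ((differentiableAt_id (𝕜 := ℝ)).add_const T).mdifferentiableAt) (1 : ℝ)
  have h1 : (mfderiv 𝓘(ℝ, ℝ) 𝓘(ℝ, ℝ) (fun s : ℝ ↦ s + T) t (1 : ℝ) : ℝ) = 1 := by
    rw [mfderiv_eq_fderiv]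
    simp only [fderiv_add_const, fderiv_fun_id]
    rfl
  exact congrArg (fun v : E ↦ (mfderiv I I (fun x ↦ (γ (t + T))⁻¹ * x) (γ (t + T)) v : E))
    ((congrArg (fun r : ℝ ↦ (mfderiv 𝓘(ℝ, ℝ) I γ (t + T) r : E)) h1).symm.trans hc.symm)

/-- The right action of `ΩG` on `PG` by pointwise multiplication. -/
noncomputable instance [LieGroup I ∞ G] : MulAction (LoopGroup I G)ᵐᵒᵖ (PathSpace I G) where
  smul γ g :=
    { toFun := g.toFun * γ.unop.1
      smooth := g.smooth.mul γ.unop.2.1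
      map_zero := by simp [g.map_zero, γ.unop.2.2.2]
      periodic := fun t ↦ by
        rw [leftLogDeriv_mul I g.smooth γ.unop.2.1, leftLogDeriv_mul I g.smooth γ.unop.2.1,
          g.periodic t, leftLogDeriv_periodic I γ.unop.2.1 γ.unop.2.2.1 t, γ.unop.2.2.1 t] }
  one_smul g := by
    apply PathSpace.ext
    exact mul_one g.toFun
  mul_smul γ δ g := by
    apply PathSpace.ext
    exact (mul_assoc g.toFun δ.unop.1 γ.unop.1).symm

/-- The projection `PG → G` of the path fibration: the value at `2π`. -/
noncomputable def pathFibration (g : PathSpace I G) : G := g (2 * Real.pi)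

variable (G) in
/-- A Higgs field on a space `P` with a right action of `ΩG`: a smooth map `Φ` to the loops in the
Lie algebra with `Φ (p γ) = ad (γ⁻¹) (Φ p) + γ⁻¹ ∂γ`. -/
structure HiggsField [LieGroup I ∞ G] (P : Type*) [DiffeologicalSpace P]
    [MulAction (LoopGroup I G)ᵐᵒᵖ P] where
  toFun : P → LoopAlgebra I G
  smooth : DSmooth toFun
  equivariant : ∀ (p : P) (γ : LoopGroup I G) (t : ℝ),
    toFun (p <• γ) t = lieAd I (γ t)⁻¹ (toFun p t) + leftLogDeriv I γ t

instance [LieGroup I ∞ G] {P : Type*} [DiffeologicalSpace P] [MulAction (LoopGroup I G)ᵐᵒᵖ P] :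
    CoeFun (HiggsField I G P) (fun _ ↦ P → LoopAlgebra I G) := ⟨HiggsField.toFun⟩

/-- The smooth map `f : M → G` is a classifying map for the `ΩG`-bundle `π : P → M`: `P` is the
pullback along `f` of the path fibration `PG → G`. -/
def IsClassifyingMap [LieGroup I ∞ G] {P M : Type*} [DiffeologicalSpace P] [DiffeologicalSpace M]
    [MulAction (LoopGroup I G)ᵐᵒᵖ P] (π : P → M) (f : M → G) : Prop :=
  @DSmooth M G _ (manifoldDiffeology I G) f ∧
    IsPullbackBundle (LoopGroup I G) π (pathFibration I (G := G)) f

end LieGroup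

/-! For a curve `ξ` in the Lie algebra, the solutions of `g⁻¹ ∂g = ξ` are permuted by constant left
translations. If `g` and `k` both solve it, `g k⁻¹` has zero logarithmic derivative, hence is
constant (`HasLogDerivAt.mul_inv_eq`). This gives uniqueness for a given `g 0`. It also lets local
solutions be glued after a left translation, so solutions exist for all time (`exists_solution`).

Smooth dependence on parameters is proved locally with the implicit function theorem in a space of
continuous curves (`exists_local_flow`), transferred to the group by the chart at `1`
(`exists_local_solution`), and spread along the time axis by an open-closed argument
(`contMDiff_of_hasLogDerivAt`). Hence `hol` is smooth. Throughout, `HasLogDerivAt` replaces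
`leftLogDeriv`, so that the calculus takes place in `E` and no differentiability of the curve has to
be known beforehand.

By the product rule `hol p * γ` has logarithmic derivative `Φ (p γ)`, so uniqueness makes `hol`
equivariant. A smooth equivariant map `P → PG` over `f : M → G` identifies `P` with the pullback
along `f`: two paths with the same endpoint differ by a unique loop, which gives bijectivity, and
local lifts of plots corrected by that loop make the inverse smooth
(`isPullbackBundle_of_equivariant`). -/

/-! ### Differentiability of superposition operators on continuous functions. -/

section Nemytskii

universe u v w
variable {K : Type w} [TopologicalSpace K] [CompactSpace K]

/-- The action of a family of operators on a family of vectors, as an operator. -/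
noncomputable def ContinuousMap.applyFamily (K : Type w) [TopologicalSpace K] [CompactSpace K]
    (Z : Type u) (W : Type v) [NormedAddCommGroup Z] [NormedSpace ℝ Z]
    [NormedAddCommGroup W] [NormedSpace ℝ W] :
    C(K, Z →L[ℝ] W) →L[ℝ] C(K, Z) →L[ℝ] C(K, W) :=
  LinearMap.mkContinuous₂
    (LinearMap.mk₂ ℝ (fun (A : C(K, Z →L[ℝ] W)) (v : C(K, Z)) ↦
        (⟨fun k ↦ A k (v k), A.continuous.clm_apply v.continuous⟩ : C(K, W)))
      (fun _ _ _ ↦ by ext; simp) (fun _ _ _ ↦ by ext; simp)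
      (fun _ _ _ ↦ by ext; simp) (fun _ _ _ ↦ by ext; simp)) 1
    (fun A v ↦ by
      rw [ContinuousMap.norm_le _ (by positivity), one_mul]
      exact fun k ↦ (A k).le_of_opNorm_le_of_le (A.norm_coe_le_norm k) (v.norm_coe_le_norm k))

/-- The mean value inequality is applied pointwise in `k`. It is uniform in `k` because `f'` is
uniformly continuous near the compact range of `x`. -/
theorem ContinuousMap.hasFDerivAt_comp {Z : Type u} {W : Type v} [NormedAddCommGroup Z]
    [NormedSpace ℝ Z] [NormedAddCommGroup W] [NormedSpace ℝ W] (f : C(Z, W))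
    (f' : C(Z, Z →L[ℝ] W)) (hf : ∀ z, HasFDerivAt f (f' z) z) (x : C(K, Z)) :
    HasFDerivAt (fun y : C(K, Z) ↦ f.comp y)
      (ContinuousMap.applyFamily K Z W (f'.comp x)) x := by
  rw [hasFDerivAt_iff_isLittleO, Asymptotics.isLittleO_iff]
  intro c hc
  have hK : IsCompact (Set.range x) := isCompact_range x.continuous
  have := hK.uniformContinuousAt_of_continuousAt f' (fun a _ ↦ f'.continuous.continuousAt)
    (Metric.dist_mem_uniformity hc)
  obtain ⟨δ, hδ, h⟩ := Metric.mem_uniformity_dist.1 this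
  filter_upwards [Metric.ball_mem_nhds x hδ] with y hy
  rw [ContinuousMap.norm_le _ (by positivity)]
  intro k
  have hk : y k ∈ Metric.ball (x k) δ :=
    (ContinuousMap.dist_apply_le_dist k).trans_lt hy
  have := (convex_ball (x k) δ).norm_image_sub_le_of_norm_hasFDerivWithin_le' (f := f)
    (f' := f') (φ := f' (x k)) (C := c) (fun z _ ↦ (hf z).hasFDerivWithinAt)
    (fun z hz ↦ by
      have h1 := h (a := x k) (b := z) (by rw [dist_comm]; exact hz) ⟨k, rfl⟩
      rw [← dist_eq_norm, dist_comm]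
      exact le_of_lt h1)
    (Metric.mem_ball_self hδ) hk
  refine this.trans ?_
  gcongr
  exact (y - x).norm_coe_le_norm k

/-- The derivative is again a superposition operator, that of `f'`, followed by the bounded linear
map `applyFamily`. The induction therefore replaces `W` by `Z →L[ℝ] W`, which is why both spaces
share a universe. -/
theorem ContinuousMap.contDiff_comp (n : ℕ) {Z W : Type u} [NormedAddCommGroup Z]
    [NormedSpace ℝ Z] [NormedAddCommGroup W] [NormedSpace ℝ W] (f : C(Z, W))
    (hf : ContDiff ℝ n f) : ContDiff ℝ n (fun y : C(K, Z) ↦ f.comp y) := by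
  induction n generalizing W with
  | zero =>
    exact contDiff_zero.2 (ContinuousMap.continuous_postcomp f)
  | succ n ih =>
    obtain ⟨f', hf', h⟩ := contDiff_succ_iff_hasFDerivAt.1 hf
    refine contDiff_succ_iff_hasFDerivAt.2
      ⟨_, ?_, ContinuousMap.hasFDerivAt_comp f ⟨f', hf'.continuous⟩ h⟩
    exact (ContinuousMap.applyFamily K Z W).contDiff.comp (ih ⟨f', hf'.continuous⟩ hf')

end Nemytskii

/-! ### Local solutions of differential equations with parameters, by the implicit function theorem.
-/

section LocalFlow

variable {E : Type*} [NormedAddCommGroup E] [NormedSpace ℝ E]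

/-- The interval `[-1, 1]`. -/
abbrev SymmInterval : Type := Set.Icc (-1 : ℝ) 1

/-- The projection of the real line onto `[-1, 1]`. -/
noncomputable def SymmInterval.proj (t : ℝ) : SymmInterval := Set.projIcc (-1) 1 (by norm_num) t

theorem SymmInterval.continuous_proj : Continuous SymmInterval.proj :=
  continuous_projIcc (h := by norm_num)

theorem SymmInterval.proj_coe (t : SymmInterval) : SymmInterval.proj t = t := Set.projIcc_val _ t

/-- The primitive vanishing at zero. -/
noncomputable def primitiveCLM (E : Type*) [NormedAddCommGroup E] [NormedSpace ℝ E] :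
    C(SymmInterval, E) →L[ℝ] C(SymmInterval, E) :=
  LinearMap.mkContinuous
    { toFun := fun w ↦ ⟨fun τ ↦ ∫ s in (0 : ℝ)..τ, w (SymmInterval.proj s), by
        exact (intervalIntegral.continuous_primitive (fun a b ↦
          (w.continuous.comp SymmInterval.continuous_proj).intervalIntegrable a b) 0).comp
            continuous_subtype_val⟩
      map_add' := fun v w ↦ by
        ext τ
        exact intervalIntegral.integral_add
          ((v.continuous.comp SymmInterval.continuous_proj).intervalIntegrable _ _)
          ((w.continuous.comp SymmInterval.continuous_proj).intervalIntegrable _ _)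
      map_smul' := fun c w ↦ by
        ext τ
        exact intervalIntegral.integral_smul c _ } 1
    (fun w ↦ by
      rw [ContinuousMap.norm_le _ (by positivity)]
      intro τ
      refine (intervalIntegral.norm_integral_le_of_norm_le_const
        (C := ‖w‖) fun s _ ↦ w.norm_coe_le_norm _).trans ?_
      rw [one_mul, sub_zero]
      exact mul_le_of_le_one_right (norm_nonneg _) (abs_le.2 τ.2))

theorem primitiveCLM_apply (w : C(SymmInterval, E)) (τ : SymmInterval) :
    primitiveCLM E w τ = ∫ s in (0 : ℝ)..τ, w (SymmInterval.proj s) := rfl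

/-- The map whose zeros are the solutions, with parameter `y` and time rescaled by `ε`, of
`u' = f ((y, t), u)` starting at `e`. -/
noncomputable def rescaledODE {Y : Type*} [NormedAddCommGroup Y] [NormedSpace ℝ Y]
    (f : C((Y × ℝ) × E, E)) (e : E) (x : (Y × ℝ) × C(SymmInterval, E)) : C(SymmInterval, E) :=
  x.2 - ContinuousMap.const _ e - x.1.2 • primitiveCLM E (f.comp
    (ContinuousLinearMap.const ℝ SymmInterval ((x.1.1, (0 : ℝ)), (0 : E)) +
      x.1.2 • (⟨fun τ ↦ ((0, (τ : ℝ)), 0), by fun_prop⟩ : C(SymmInterval, (Y × ℝ) × E)) +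
      (ContinuousLinearMap.inr ℝ (Y × ℝ) E).compLeftContinuous ℝ SymmInterval x.2))

variable {Y : Type*} [NormedAddCommGroup Y] [NormedSpace ℝ Y]

theorem rescaledODE_apply (f : C((Y × ℝ) × E, E)) (e : E) (y : Y) (ε : ℝ) (u : C(SymmInterval, E))
    (τ : SymmInterval) :
    rescaledODE f e ((y, ε), u) τ = u τ - e - ε • ∫ s in (0 : ℝ)..τ,
      f ((y, ε * SymmInterval.proj s), u (SymmInterval.proj s)) := by
  simp [rescaledODE, primitiveCLM_apply]

/-- At `ε = 0` the nonlinear term disappears, so the partial derivative in `u` is the identity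
whatever `f` is. -/
theorem rescaledODE_zero (f : C((Y × ℝ) × E, E)) (e : E) (y : Y) (u : C(SymmInterval, E)) :
    rescaledODE f e ((y, 0), u) = u - ContinuousMap.const _ e := by
  ext τ
  simp [rescaledODE_apply]

end LocalFlow

section LocalFlowSmooth

universe u
variable {E : Type u} [NormedAddCommGroup E] [NormedSpace ℝ E]
  {Y : Type} [NormedAddCommGroup Y] [NormedSpace ℝ Y]

theorem contDiff_rescaledODE (n : ℕ) (f : C((Y × ℝ) × E, E)) (hf : ContDiff ℝ n f) (e : E) :
    ContDiff ℝ n (rescaledODE f e) := by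
  refine (contDiff_snd.sub contDiff_const).sub (contDiff_fst.snd.smul
    ((primitiveCLM E).contDiff.comp ((ContinuousMap.contDiff_comp n f hf).comp
      (((ContinuousLinearMap.contDiff _).comp ?_ |>.add (contDiff_fst.snd.smul contDiff_const)).add
        ((ContinuousLinearMap.contDiff _).comp contDiff_snd)))))
  exact (contDiff_fst.fst.prodMk contDiff_const).prodMk contDiff_const

/-- This is the substitution `s ↦ l * s` in the integral. Slowing time down by `l` turns dependence
on `ε` into dependence on time. -/
theorem rescaledODE_rescale (f : C((Y × ℝ) × E, E)) (e : E) (y : Y) (ε : ℝ)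
    (u : C(SymmInterval, E)) (l : SymmInterval) (h : rescaledODE f e ((y, ε), u) = 0) :
    rescaledODE f e ((y, l * ε), u.comp ⟨fun τ : SymmInterval ↦ SymmInterval.proj (l * τ),
      SymmInterval.continuous_proj.comp (by fun_prop)⟩) = 0 := by
  have hmem : ∀ s ∈ Set.Icc (-1 : ℝ) 1, (l : ℝ) * s ∈ Set.Icc (-1 : ℝ) 1 := fun s hs ↦ by
    rw [Set.mem_Icc, ← abs_le, abs_mul]
    exact mul_le_one₀ (abs_le.2 l.2) (abs_nonneg _) (abs_le.2 hs)
  ext τ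
  have h1 := DFunLike.congr_fun h (SymmInterval.proj (l * τ))
  have hτ : ((SymmInterval.proj (l * τ) : SymmInterval) : ℝ) = l * τ :=
    congrArg Subtype.val (Set.projIcc_of_mem _ (hmem τ τ.2))
  rw [rescaledODE_apply, hτ, ContinuousMap.zero_apply] at h1
  rw [rescaledODE_apply, ContinuousMap.zero_apply, ← h1]
  simp only [ContinuousMap.comp_apply, ContinuousMap.coe_mk]
  congr 1
  have h2 := intervalIntegral.smul_integral_comp_mul_left (a := 0) (b := (τ : ℝ))
    (fun s ↦ f ((y, ε * SymmInterval.proj s), u (SymmInterval.proj s))) (l : ℝ)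
  rw [mul_zero] at h2
  rw [← h2, mul_comm, mul_smul]
  congr 2
  refine intervalIntegral.integral_congr fun s hs ↦ ?_
  have hs' : s ∈ Set.Icc (-1 : ℝ) 1 :=
    (Set.uIcc_subset_Icc ⟨by norm_num, by norm_num⟩ τ.2) hs
  have e1 : ((SymmInterval.proj s : SymmInterval) : ℝ) = s :=
    congrArg Subtype.val (Set.projIcc_of_mem _ hs')
  have e2 : ((SymmInterval.proj (l * s) : SymmInterval) : ℝ) = l * s :=
    congrArg Subtype.val (Set.projIcc_of_mem _ (hmem s hs'))
  simp only [e1, e2]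
  congr 3
  ring

/-- Local solutions of an ordinary differential equation depend smoothly on parameters. -/
theorem exists_local_flow [CompleteSpace E] [CompleteSpace Y] (n : ℕ) (hn : n ≠ 0)
    (f : (Y × ℝ) × E → E) (hf : ContDiff ℝ n f) (e : E) (y₀ : Y) :
    ∃ h : Y × ℝ → E, ContDiffAt ℝ n h (y₀, 0) ∧ h (y₀, 0) = e ∧
      ∀ᶠ z in 𝓝 (y₀, (0 : ℝ)), HasDerivAt (fun t ↦ h (z.1, t)) (f (z, h z)) z.2 := by
  set F := rescaledODE (⟨f, hf.continuous⟩ : C((Y × ℝ) × E, E)) e with hF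
  set u₀ : (Y × ℝ) × C(SymmInterval, E) := ((y₀, 0), ContinuousMap.const _ e) with hu₀
  have hn' : (n : WithTop ℕ∞) ≠ 0 := by exact_mod_cast hn
  have hFn : ContDiffAt ℝ n F u₀ := (contDiff_rescaledODE n _ hf e).contDiffAt
  have hF0 : F u₀ = 0 := by rw [hF, hu₀, rescaledODE_zero, sub_self]
  -- The hypothesis of the implicit function theorem: the partial derivative in `u` at `ε = 0` is
  -- the identity.
  have hinv : (fderiv ℝ F u₀ ∘L .inr ℝ (Y × ℝ) C(SymmInterval, E)).IsInvertible := by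
    have h1 : HasFDerivAt (fun u ↦ F ((y₀, 0), u)) (ContinuousLinearMap.id ℝ C(SymmInterval, E))
        (ContinuousMap.const _ e) := by
      simp only [hF, rescaledODE_zero]
      exact (hasFDerivAt_id _).sub_const _
    have h2 : HasFDerivAt (fun u ↦ F ((y₀, 0), u))
        (fderiv ℝ F u₀ ∘L .inr ℝ (Y × ℝ) C(SymmInterval, E)) (ContinuousMap.const _ e) :=
      (hFn.differentiableAt hn').hasFDerivAt.comp _ (hasFDerivAt_prodMk_right _ _)
    rw [h2.unique h1]
    exact ⟨ContinuousLinearEquiv.refl ℝ _, rfl⟩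
  set ψ := hFn.implicitFunction hn' hinv with hψ
  have hψn : ContDiffAt ℝ n ψ (y₀, 0) := hFn.contDiffAt_implicitFunction hn' hinv
  have hψ0 : ψ (y₀, 0) = ContinuousMap.const _ e := hFn.implicitFunction_apply_self hn' hinv
  have hex : ∀ᶠ x in 𝓝 (y₀, (0 : ℝ)), F (x, ψ x) = 0 := by
    simpa [hF0] using hFn.eventually_apply_implicitFunction hn' hinv
  have huniq : ∀ᶠ v in 𝓝 u₀, F v = 0 → ψ v.1 = v.2 := by
    filter_upwards [hFn.eventually_apply_eq_iff_implicitFunction hn' hinv] with v hv h0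
    exact hv.1 (h0.trans hF0.symm)
  obtain ⟨δ, hδ, hu⟩ := Metric.eventually_nhds_iff.1 huniq
  have hnear : ∀ᶠ x in 𝓝 (y₀, (0 : ℝ)), dist (ψ x) (ContinuousMap.const _ e) < δ := by
    have := hψn.continuousAt.eventually (Metric.ball_mem_nhds _ hδ)
    rwa [hψ0] at this
  obtain ⟨η, hη, hx⟩ := Metric.eventually_nhds_iff.1 (hex.and hnear)
  let one : SymmInterval := ⟨1, by norm_num⟩
  let r := min δ η / 2
  have hr : 0 < r := by positivity
  have hrδ : r < δ := (half_lt_self (by positivity)).trans_le (min_le_left _ _)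
  have hrη : r < η := (half_lt_self (by positivity)).trans_le (min_le_right _ _)
  have hdist : ∀ (y : Y) (s : ℝ), dist y y₀ < r → |s| ≤ r →
      dist (y, s) (y₀, (0 : ℝ)) ≤ r := fun y s hy hs ↦
    max_le hy.le (by simpa using hs)
  -- The slowed-down curve is also a zero close to `u₀`, so local uniqueness identifies it with `ψ
  -- (y, l * r)`. Thus evaluating `ψ (y, t)` at the fixed time `1` traces the solution in `t`, and
  -- smoothness of `ψ` in `ε` becomes smoothness in time.
  have key : ∀ y, dist y y₀ < r → ∀ l : SymmInterval, ψ (y, l * r) one = ψ (y, r) l := by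
    intro y hy l
    have h1 := hx ((hdist y r hy (abs_of_pos hr).le).trans_lt hrη)
    have h2 := rescaledODE_rescale _ e y r (ψ (y, r)) l h1.1
    have h3 : dist ((y, l * r), (ψ (y, r)).comp ⟨fun τ : SymmInterval ↦ SymmInterval.proj (l * τ),
        SymmInterval.continuous_proj.comp (by fun_prop)⟩) u₀ < δ := by
      rw [Prod.dist_eq]
      refine max_lt ((hdist y _ hy ?_).trans_lt hrδ) ?_
      · rw [abs_mul, abs_of_pos hr]
        exact mul_le_of_le_one_left hr.le (abs_le.2 l.2)
      · rw [ContinuousMap.dist_lt_iff hδ]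
        exact fun τ ↦ (ContinuousMap.dist_apply_le_dist (f := ψ (y, r))
          (g := ContinuousMap.const _ e) _).trans_lt h1.2
    have h4 := DFunLike.congr_fun (hu h3 h2) one
    simpa [one, SymmInterval.proj_coe] using h4
  refine ⟨fun z ↦ ψ z one, ?_, ?_, ?_⟩
  · exact (ContinuousMap.evalCLM ℝ one).contDiff.contDiffAt.comp _ hψn
  · simp [hψ0]
  have hball : Metric.ball (y₀, (0 : ℝ)) r ∈ 𝓝 (y₀, (0 : ℝ)) := Metric.ball_mem_nhds _ hr
  filter_upwards [hball] with z hz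
  obtain ⟨y, s⟩ := z
  rw [Metric.mem_ball, Prod.dist_eq, max_lt_iff, Real.dist_eq, sub_zero] at hz
  obtain ⟨hy, hs⟩ := hz
  have h1 := (hx ((hdist y r hy (abs_of_pos hr).le).trans_lt hrη)).1
  have hsol : ∀ t, |t| ≤ r → ψ (y, t) one =
      e + r • ∫ s in (0 : ℝ)..(t / r),
        f ((y, r * SymmInterval.proj s), ψ (y, r) (SymmInterval.proj s)) := by
    intro t ht
    have hl : t / r ∈ Set.Icc (-1 : ℝ) 1 := by
      rw [Set.mem_Icc, ← abs_le, abs_div, abs_of_pos hr]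
      exact (div_le_one hr).2 ht
    have h2 := key y hy ⟨t / r, hl⟩
    have h3 := DFunLike.congr_fun h1 (⟨t / r, hl⟩ : SymmInterval)
    rw [hF, rescaledODE_apply, ContinuousMap.zero_apply, sub_sub, sub_eq_zero] at h3
    simp only [div_mul_cancel₀ _ hr.ne'] at h2
    rw [h2]
    exact h3
  have hcont : Continuous fun s : ℝ ↦
      f ((y, r * SymmInterval.proj s), ψ (y, r) (SymmInterval.proj s)) := by
    have := SymmInterval.continuous_proj
    have := hf.continuous
    fun_prop
  have hd0 := intervalIntegral.integral_hasDerivAt_right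
    (hcont.intervalIntegrable 0 (s / r)) (hcont.stronglyMeasurableAtFilter _ _)
    hcont.continuousAt
  have hd := ((hd0.scomp s ((hasDerivAt_id s).div_const r)).const_smul r).const_add e
  have hl : s / r ∈ Set.Icc (-1 : ℝ) 1 := by
    rw [Set.mem_Icc, ← abs_le, abs_div, abs_of_pos hr]
    exact (div_le_one hr).2 hs.le
  have h2 := key y hy ⟨s / r, hl⟩
  have e1 : SymmInterval.proj (s / r) = ⟨s / r, hl⟩ := Set.projIcc_of_mem _ hl
  simp only [div_mul_cancel₀ _ hr.ne'] at h2
  rw [e1, ← h2, smul_smul, mul_one_div_cancel hr.ne', one_smul, mul_div_cancel₀ _ hr.ne'] at hd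
  refine hd.congr_of_eventuallyEq ?_
  filter_upwards [(isOpen_lt continuous_abs continuous_const).mem_nhds hs] with t ht
  exact hsol t (le_of_lt ht)

end LocalFlowSmooth

/-! ### Calculus of logarithmic derivatives in the chart at the identity. -/

section LogDeriv

variable {E H : Type*} [NormedAddCommGroup E] [NormedSpace ℝ E] [TopologicalSpace H]
  (I : ModelWithCorners ℝ E H) {G : Type*} [TopologicalSpace G] [ChartedSpace H G] [Group G]

/-- `g` is continuous at `t` and `τ ↦ (g t)⁻¹ * g τ`, read in the chart at `1`, has derivative `v`
at `t`. -/
def HasLogDerivAt (g : ℝ → G) (v : E) (t : ℝ) : Prop :=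
  ContinuousAt g t ∧ HasDerivAt (fun τ ↦ extChartAt I (1 : G) ((g t)⁻¹ * g τ)) v t

variable {I}

theorem HasLogDerivAt.unique {g : ℝ → G} {v w : E} {t : ℝ} (h : HasLogDerivAt I g v t)
    (h' : HasLogDerivAt I g w t) : v = w :=
  h.2.unique h'.2

theorem HasLogDerivAt.congr_of_eventuallyEq {g g' : ℝ → G} {v : E} {t : ℝ}
    (h : HasLogDerivAt I g v t) (hg : g' =ᶠ[𝓝 t] g) : HasLogDerivAt I g' v t := by
  refine ⟨h.1.congr hg.symm, h.2.congr_of_eventuallyEq ?_⟩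
  filter_upwards [hg] with τ hτ
  rw [hτ, hg.self_of_nhds]

theorem HasLogDerivAt.comp_sub_const {g : ℝ → G} {v : E} {t s : ℝ}
    (h : HasLogDerivAt I g v (t - s)) : HasLogDerivAt I (fun τ ↦ g (τ - s)) v t :=
  ⟨ContinuousAt.comp (f := fun τ ↦ τ - s) h.1 (by fun_prop), h.2.comp_sub_const t s⟩

theorem HasLogDerivAt.comp_add_const {g : ℝ → G} {v : E} {t s : ℝ}
    (h : HasLogDerivAt I g v (t + s)) : HasLogDerivAt I (fun τ ↦ g (τ + s)) v t :=
  ⟨ContinuousAt.comp (f := fun τ ↦ τ + s) h.1 (by fun_prop), h.2.comp_add_const t s⟩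

/-- Two curves with the same value and logarithmic derivative at `t` can be glued there. -/
theorem HasLogDerivAt.piecewise {g k : ℝ → G} {v : E} {t : ℝ} (hg : HasLogDerivAt I g v t)
    (hk : HasLogDerivAt I k v t) (hgk : g t = k t) :
    HasLogDerivAt I (fun τ ↦ if τ ≤ t then g τ else k τ) v t := by
  have h1 : Set.EqOn (fun τ ↦ if τ ≤ t then g τ else k τ) g (Set.Iic t) := fun τ hτ ↦ if_pos hτ
  have h2 : Set.EqOn (fun τ ↦ if τ ≤ t then g τ else k τ) k (Set.Ici t) := fun τ hτ ↦ by
    rcases (Set.mem_Ici.1 hτ).eq_or_lt with rfl | h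
    · simp [hgk]
    · exact if_neg (not_le.2 h)
  refine ⟨?_, ?_⟩
  · rw [← continuousWithinAt_univ, ← Set.Iic_union_Ici (a := t)]
    exact (hg.1.continuousWithinAt.congr h1 (h1 Set.self_mem_Iic)).union
      (hk.1.continuousWithinAt.congr h2 (h2 Set.self_mem_Ici))
  · rw [← hasDerivWithinAt_univ, ← Set.Iic_union_Ici (a := t)]
    simp only [le_refl, if_true]
    refine (hg.2.hasDerivWithinAt.congr (fun τ hτ ↦ ?_) ?_).union
      (hk.2.hasDerivWithinAt.congr (fun τ hτ ↦ ?_) ?_)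
    · have := h1 hτ
      simp only at this
      rw [this]
    · simp
    · have := h2 hτ
      simp only at this
      rw [this, hgk]
    · simp [hgk]

variable [LieGroup I ∞ G]

theorem HasLogDerivAt.const_mul {g : ℝ → G} {v : E} {t : ℝ} (h : HasLogDerivAt I g v t) (a : G) :
    HasLogDerivAt I (fun τ ↦ a * g τ) v t := by
  have := topologicalGroup_of_lieGroup I ∞ (G := G)
  refine ⟨continuousAt_const.mul h.1, ?_⟩
  simpa [mul_assoc] using h.2

/-- A left translation moves `k` to the value of `g` at `b` without changing its logarithmic
derivative. -/
theorem HasLogDerivAt.exists_extension {ξ : ℝ → E} {g k : ℝ → G} {a b c : ℝ} (hab : a ≤ b)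
    (hg : ∀ t ∈ Set.Icc a b, HasLogDerivAt I g (ξ t) t)
    (hk : ∀ t ∈ Set.Icc b c, HasLogDerivAt I k (ξ t) t) (hbc : b ≤ c) :
    ∃ g' : ℝ → G, ∀ t ∈ Set.Icc a c, HasLogDerivAt I g' (ξ t) t := by
  refine ⟨fun τ ↦ if τ ≤ b then g τ else g b * (k b)⁻¹ * k τ, fun t ht ↦ ?_⟩
  rcases lt_trichotomy t b with h | rfl | h
  · refine (hg t ⟨ht.1, h.le⟩).congr_of_eventuallyEq ?_
    filter_upwards [eventually_lt_nhds h] with τ hτ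
    exact if_pos hτ.le
  · exact (hg t ⟨hab, le_rfl⟩).piecewise ((hk t ⟨le_rfl, hbc⟩).const_mul _) (by group)
  · refine ((hk t ⟨h.le, ht.2⟩).const_mul (g b * (k b)⁻¹)).congr_of_eventuallyEq ?_
    filter_upwards [eventually_gt_nhds h] with τ hτ
    exact if_neg (not_le.2 hτ)

variable (I) in
theorem eventually_inv_mul_mem_extChartAt_source {c : ℝ → G} {t : ℝ} (hc : ContinuousAt c t) :
    ∀ᶠ τ in 𝓝 t, (c t)⁻¹ * c τ ∈ (extChartAt I (1 : G)).source := by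
  have := topologicalGroup_of_lieGroup I ∞ (G := G)
  have h : ContinuousAt (fun τ ↦ (c t)⁻¹ * c τ) t := continuousAt_const.mul hc
  refine h.eventually_mem ?_
  rw [inv_mul_cancel]
  exact extChartAt_source_mem_nhds (I := I) (1 : G)

theorem ContMDiffAt.contDiffAt_extChartAt {X : Type*} [NormedAddCommGroup X] [NormedSpace ℝ X]
    {n : WithTop ℕ∞} (hn : n ≤ ∞) {k : X → G} {x : X} (hk : ContMDiffAt 𝓘(ℝ, X) I n k x)
    (hx : k x ∈ (extChartAt I (1 : G)).source) :
    ContDiffAt ℝ n (fun y ↦ extChartAt I (1 : G) (k y)) x := by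
  have : IsManifold I ∞ G := ContMDiffMul.toIsManifold
  have : IsManifold I n G := IsManifold.of_le hn
  rw [extChartAt_source] at hx
  exact ((contMDiffAt_extChartAt' hx).comp x hk).contDiffAt

theorem MDifferentiableAt.hasLogDerivAt {g : ℝ → G} {t : ℝ}
    (hg : MDifferentiableAt 𝓘(ℝ, ℝ) I g t) : HasLogDerivAt I g (leftLogDeriv I g t) t := by
  refine ⟨hg.continuousAt, ?_⟩
  have hL : MDifferentiableAt I I (fun x ↦ (g t)⁻¹ * x) (g t) :=
    (contMDiff_mul_left (I := I) (n := ∞) (a := (g t)⁻¹)).mdifferentiable (by simp) _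
  have h := (HasMFDerivAt.comp t hL.hasMFDerivAt hg.hasMFDerivAt).2
  have e : ((fun x ↦ (g t)⁻¹ * x) ∘ g) t = 1 := inv_mul_cancel (g t)
  simp only [writtenInExtChartAt, e, extChartAt_model_space_eq_id,
    modelWithCornersSelf_coe, Set.range_id] at h
  have h' : HasFDerivAt (𝕜 := ℝ) (E := ℝ) (F := E)
      (fun τ ↦ extChartAt I (1 : G) ((g t)⁻¹ * g τ))
      (show ℝ →L[ℝ] E from (mfderiv I I (fun x ↦ (g t)⁻¹ * x) (g t)).comp
        (mfderiv 𝓘(ℝ, ℝ) I g t)) t := hasFDerivWithinAt_univ.1 h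
  exact h'.hasDerivAt

variable [I.Boundaryless]

theorem ContDiffAt.contMDiffAt_extChartAt_symm {X : Type*} [NormedAddCommGroup X]
    [NormedSpace ℝ X] {n : WithTop ℕ∞} (hn : n ≤ ∞) {h : X → E} {x : X} (hh : ContDiffAt ℝ n h x)
    (hx : h x ∈ (extChartAt I (1 : G)).target) :
    ContMDiffAt 𝓘(ℝ, X) I n (fun y ↦ (extChartAt I (1 : G)).symm (h y)) x := by
  have : IsManifold I ∞ G := ContMDiffMul.toIsManifold
  have : IsManifold I n G := IsManifold.of_le hn
  exact ((contMDiffOn_extChartAt_symm (1 : G)).contMDiffAt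
    ((isOpen_extChartAt_target (1 : G)).mem_nhds hx)).comp x hh.contMDiffAt

/-- Relative to its value at `t`, the quotient is `Ψ` applied to the chart readings of `g` and `k`.
Since `Ψ` is constant on the diagonal, its derivative kills `(v, v)`. -/
theorem HasLogDerivAt.mul_inv {g k : ℝ → G} {v : E} {t : ℝ} (hg : HasLogDerivAt I g v t)
    (hk : HasLogDerivAt I k v t) : HasLogDerivAt I (fun τ ↦ g τ * (k τ)⁻¹) (0 : E) t := by
  have := topologicalGroup_of_lieGroup I ∞ (G := G)
  refine ⟨hg.1.mul hk.1.inv, ?_⟩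
  set φ := extChartAt I (1 : G) with hφ
  let Ψ : E × E → G := fun x ↦ k t * (φ.symm x.1 * (φ.symm x.2)⁻¹) * (k t)⁻¹
  have hφ1 : φ.symm (φ 1) = 1 := extChartAt_to_inv (I := I) (1 : G)
  have ht : φ 1 ∈ φ.target := mem_extChartAt_target (I := I) (1 : G)
  have hΨ : ContMDiffAt 𝓘(ℝ, E × E) I ∞ Ψ (φ 1, φ 1) :=
    (contMDiffAt_const.mul (ContDiffAt.contMDiffAt_extChartAt_symm le_rfl contDiffAt_fst ht |>.mul
      (ContDiffAt.contMDiffAt_extChartAt_symm le_rfl contDiffAt_snd ht).inv)).mul contMDiffAt_const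
  have hΨ1 : Ψ (φ 1, φ 1) = 1 := by simp [Ψ]
  have hd := (hΨ.contDiffAt_extChartAt le_rfl
    (by rw [hΨ1]; exact mem_extChartAt_source (I := I) (1 : G))).differentiableAt (by simp)
      |>.hasFDerivAt
  set D := fderiv ℝ (fun y ↦ φ (Ψ y)) (φ 1, φ 1)
  have hD : D (v, v) = 0 := by
    have h1 : HasDerivAt (fun s : ℝ ↦ (φ 1 + s • v, φ 1 + s • v)) (v, v) 0 := by
      have : HasDerivAt (fun s : ℝ ↦ φ 1 + s • v) v 0 := by
        simpa using ((hasDerivAt_id (0 : ℝ)).smul_const v).const_add (φ 1)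
      exact this.prodMk this
    have h2 := HasFDerivAt.comp_hasDerivAt (l := fun y ↦ φ (Ψ y)) (l' := D) (0 : ℝ)
      (by simpa only [zero_smul, add_zero] using hd) h1
    have h3 : (fun y ↦ φ (Ψ y)) ∘ (fun s : ℝ ↦ (φ 1 + s • v, φ 1 + s • v)) =
        fun _ ↦ φ (Ψ (φ 1, φ 1)) := by
      funext s
      simp [Ψ]
    rw [h3] at h2
    exact h2.unique (hasDerivAt_const _ _)
  have h4 := HasFDerivAt.comp_hasDerivAt (l := fun y ↦ φ (Ψ y)) (l' := D) t
    (by simpa only [inv_mul_cancel] using hd) (hg.2.prodMk hk.2)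
  rw [hD] at h4
  refine h4.congr_of_eventuallyEq ?_
  filter_upwards [eventually_inv_mul_mem_extChartAt_source I hg.1,
    eventually_inv_mul_mem_extChartAt_source I hk.1] with τ h5 h6
  simp only [Ψ, Function.comp_apply, ← hφ, φ.left_inv h5, φ.left_inv h6]
  congr 1
  group

/-- A curve with vanishing logarithmic derivative is constant. -/
theorem HasLogDerivAt.eq_of_zero {s : Set ℝ} (hs : IsOpen s) (hs' : IsPreconnected s) {q : ℝ → G}
    (hq : ∀ t ∈ s, HasLogDerivAt I q (0 : E) t) {a b : ℝ} (ha : a ∈ s) (hb : b ∈ s) :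
    q a = q b := by
  have := topologicalGroup_of_lieGroup I ∞ (G := G)
  set φ := extChartAt I (1 : G) with hφ
  have hloc : ∀ t ∈ s, ∀ᶠ τ in 𝓝 t, q τ = q t := by
    intro t ht
    have hsrc := eventually_inv_mul_mem_extChartAt_source I (hq t ht).1
    obtain ⟨δ, hδ, hball⟩ := Metric.eventually_nhds_iff_ball.1 (hsrc.and (hs.mem_nhds ht))
    -- The hypothesis at `τ` uses `q τ` as base point, whereas here the base point is `q t`. The two
    -- chart readings differ by the smooth map `φ ∘ Ψ`, so the derivative is still zero.
    have hder : ∀ τ ∈ Metric.ball t δ, HasDerivAt (fun τ ↦ φ ((q t)⁻¹ * q τ)) 0 τ := by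
      intro τ hτ
      let Ψ : E → G := fun x ↦ (q t)⁻¹ * q τ * φ.symm x
      have hΨ : ContMDiffAt 𝓘(ℝ, E) I ∞ Ψ (φ 1) :=
        contMDiffAt_const.mul (ContDiffAt.contMDiffAt_extChartAt_symm le_rfl contDiffAt_id
          (mem_extChartAt_target (I := I) (1 : G)))
      have hΨ1 : Ψ (φ 1) = (q t)⁻¹ * q τ := by
        simp [Ψ, hφ, extChartAt_to_inv, -extChartAt]
      have hd := (hΨ.contDiffAt_extChartAt le_rfl
        (by rw [hΨ1]; exact (hball τ hτ).1)).differentiableAt (by simp) |>.hasFDerivAt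
      have h1 := hq τ (hball τ hτ).2
      have h2 := HasFDerivAt.comp_hasDerivAt (l := fun y ↦ φ (Ψ y)) τ
        (by simpa only [inv_mul_cancel] using hd) h1.2
      rw [map_zero] at h2
      refine h2.congr_of_eventuallyEq ?_
      filter_upwards [eventually_inv_mul_mem_extChartAt_source I h1.1] with σ hσ
      simp only [Ψ, Function.comp_apply, ← hφ, φ.left_inv hσ]
      congr 1
      group
    filter_upwards [Metric.ball_mem_nhds t hδ] with τ hτ
    have h3 := (convex_ball t δ).is_const_of_fderivWithin_eq_zero (𝕜 := ℝ)
      (f := fun τ ↦ φ ((q t)⁻¹ * q τ))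
      (fun x hx ↦ (hder x hx).differentiableAt.differentiableWithinAt)
      (fun x hx ↦ by
        rw [fderivWithin_of_isOpen Metric.isOpen_ball hx]
        ext
        simp [(hder x hx).deriv]) (Metric.mem_ball_self hδ) hτ
    have h4 := φ.injOn (hball t (Metric.mem_ball_self hδ)).1 (hball τ hτ).1 h3
    exact (mul_left_cancel h4).symm
  have : IsLocallyConstant (s.domRestrict q) := by
    rw [IsLocallyConstant.iff_eventually_eq]
    intro x
    exact continuous_subtype_val.continuousAt.eventually (hloc x x.2)
  have hps := Subtype.preconnectedSpace hs'
  exact this.apply_eq_of_preconnectedSpace ⟨a, ha⟩ ⟨b, hb⟩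

/-- Curves with the same logarithmic derivative differ by a constant factor on the left. -/
theorem HasLogDerivAt.mul_inv_eq {s : Set ℝ} (hs : IsOpen s) (hs' : IsPreconnected s)
    {g k : ℝ → G} {ξ : ℝ → E} (hg : ∀ t ∈ s, HasLogDerivAt I g (ξ t) t)
    (hk : ∀ t ∈ s, HasLogDerivAt I k (ξ t) t) {a b : ℝ} (ha : a ∈ s) (hb : b ∈ s) :
    g b = g a * (k a)⁻¹ * k b := by
  rw [HasLogDerivAt.eq_of_zero hs hs' (fun t ht ↦ (hg t ht).mul_inv (hk t ht)) ha hb]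
  group

end LogDeriv

/-! ### Local solutions of the equation in the group. -/

section LocalSolution

universe u
variable {E : Type u} {H : Type*} [NormedAddCommGroup E] [NormedSpace ℝ E] [FiniteDimensional ℝ E]
  [TopologicalSpace H]
  {I : ModelWithCorners ℝ E H} [I.Boundaryless] {G : Type*} [TopologicalSpace G] [ChartedSpace H G]
  [Group G] [LieGroup I ∞ G] {Y : Type} [NormedAddCommGroup Y] [NormedSpace ℝ Y] [CompleteSpace Y]

variable (I G) in
/-- A globally defined smooth function that near the image `e` of `1` in the chart at `1` is the
left-invariant vector field with value `w` at `1`. -/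
theorem exists_invariant_field : ∃ f : E × E → E, ContDiff ℝ ∞ f ∧
    ∀ᶠ u in 𝓝 (extChartAt I (1 : G) 1), ∀ w, HasFDerivAt (fun v ↦ extChartAt I (1 : G)
      ((extChartAt I (1 : G)).symm u * (extChartAt I (1 : G)).symm v))
        (fderiv ℝ (fun v ↦ extChartAt I (1 : G)
      ((extChartAt I (1 : G)).symm u * (extChartAt I (1 : G)).symm v)) (extChartAt I (1 : G) 1))
        (extChartAt I (1 : G) 1) ∧
      fderiv ℝ (fun v ↦ extChartAt I (1 : G)
      ((extChartAt I (1 : G)).symm u * (extChartAt I (1 : G)).symm v)) (extChartAt I (1 : G) 1) w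
        = f (u, w) := by
  have := topologicalGroup_of_lieGroup I ∞ (G := G)
  set φ := extChartAt I (1 : G) with hφ
  set e := φ 1 with he
  let m : E → E → E := fun u v ↦ φ (φ.symm u * φ.symm v)
  have hφ1 : φ.symm e = 1 := extChartAt_to_inv (I := I) (1 : G)
  have ht : e ∈ φ.target := mem_extChartAt_target (I := I) (1 : G)
  have hev : ∀ᶠ u in 𝓝 e, u ∈ φ.target ∧ φ.symm u * φ.symm e ∈ φ.source := by
    refine Filter.Eventually.and (extChartAt_target_mem_nhds (I := I) (1 : G)) ?_
    have hc : ContinuousAt (fun u ↦ φ.symm u * φ.symm e) e :=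
      (continuousAt_extChartAt_symm (I := I) (1 : G)).mul continuousAt_const
    refine hc.eventually_mem ?_
    rw [hφ1, mul_one]
    exact extChartAt_source_mem_nhds (I := I) (1 : G)
  have hm : ∀ u, u ∈ φ.target ∧ φ.symm u * φ.symm e ∈ φ.source →
      ContDiffAt ℝ ∞ (fun x : E × E ↦ m x.1 x.2) (u, e) := fun u hu ↦
    ContMDiffAt.contDiffAt_extChartAt le_rfl
      ((ContDiffAt.contMDiffAt_extChartAt_symm le_rfl contDiffAt_fst hu.1).mul
        (ContDiffAt.contMDiffAt_extChartAt_symm le_rfl contDiffAt_snd ht)) hu.2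
  obtain ⟨r, hr, hball⟩ := Metric.eventually_nhds_iff_ball.1 hev
  -- The chart expression of the field is only controlled for `u` near `e`. The cutoff makes it
  -- smooth on all of `E × E`; no cutoff in `w` is needed.
  let χ : ContDiffBump e := ⟨r / 3, r / 2, by positivity, by linarith⟩
  have hf0 : ∀ u ∈ Metric.ball e r, ∀ w : E,
      ContDiffAt ℝ ∞ (fun x : E × E ↦ fderiv ℝ (m x.1) e x.2) (u, w) := by
    intro u hu w
    have h1 : ContDiffAt ℝ ∞ (Function.uncurry fun (x : E × E) v ↦ m x.1 v) ((u, w), e) :=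
      ContDiffAt.comp (g := fun x : E × E ↦ m x.1 x.2) ((u, w), e) (hm u (hball u hu))
        (contDiffAt_fst.fst.prodMk contDiffAt_snd)
    exact (h1.fderiv (n := ∞) contDiffAt_const (by simp)).clm_apply contDiffAt_snd
  refine ⟨fun x ↦ χ x.1 • fderiv ℝ (m x.1) e x.2, ?_, ?_⟩
  · rw [contDiff_iff_contDiffAt]
    rintro ⟨u, w⟩
    by_cases hu : u ∈ Metric.ball e r
    · exact (χ.contDiff.contDiffAt.comp (u, w) contDiffAt_fst).smul (hf0 u hu w)
    · refine contDiffAt_const (c := (0 : E)) |>.congr_of_eventuallyEq ?_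
      have hu' : u ∉ tsupport χ := fun h ↦ hu (by
        rw [χ.tsupport_eq] at h
        exact Metric.closedBall_subset_ball (by change r / 2 < r; linarith) h)
      have : ∀ᶠ x : E × E in 𝓝 (u, w), x.1 ∈ (tsupport χ)ᶜ :=
        continuousAt_fst.eventually_mem ((isClosed_tsupport χ).isOpen_compl.mem_nhds hu')
      filter_upwards [this] with x hx
      rw [image_eq_zero_of_notMem_tsupport hx, zero_smul]
  · filter_upwards [χ.eventuallyEq_one, hev] with u hu hu' w
    refine ⟨?_, ?_⟩
    · exact ((hm u hu').comp e (contDiffAt_const.prodMk contDiffAt_id)).differentiableAt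
        (by simp) |>.hasFDerivAt
    · simp only [hu, Pi.one_apply, one_smul]
      rfl

/-- In the chart the equation reads `u' = f (u, ξ)`, with time shifted by `t₀`. No initial value is
recorded, as solutions may be translated freely. The order `n` is finite so that being `C^n` at a
point extends to a neighbourhood. -/
theorem exists_local_solution (n : ℕ) (hn : n ≠ 0) (ξ : Y × ℝ → E) (hξ : ContDiff ℝ ∞ ξ)
    (y₀ : Y) (t₀ : ℝ) : ∃ k : Y × ℝ → G, ∀ᶠ z in 𝓝 (y₀, t₀),
      ContMDiffAt 𝓘(ℝ, Y × ℝ) I n k z ∧ HasLogDerivAt I (fun t ↦ k (z.1, t)) (ξ z) z.2 := by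
  have := topologicalGroup_of_lieGroup I ∞ (G := G)
  have := FiniteDimensional.complete ℝ E
  obtain ⟨f, hf, hfe⟩ := exists_invariant_field I G
  set φ := extChartAt I (1 : G) with hφ
  set e := φ 1 with he
  have hφ1 : φ.symm e = 1 := extChartAt_to_inv (I := I) (1 : G)
  have ht : e ∈ φ.target := mem_extChartAt_target (I := I) (1 : G)
  have hnle : (n : WithTop ℕ∞) ≤ ∞ := by exact_mod_cast le_top
  obtain ⟨h, hh, hh0, hsol⟩ := exists_local_flow n hn
    (fun x : (Y × ℝ) × E ↦ f (x.2, ξ (x.1.1, t₀ + x.1.2)))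
    ((hf.of_le hnle).comp (contDiff_snd.prodMk ((hξ.of_le hnle).comp
      (contDiff_fst.fst.prodMk (contDiff_const.add contDiff_fst.snd))))) e y₀
  refine ⟨fun z ↦ φ.symm (h (z.1, z.2 - t₀)), ?_⟩
  have hshift : Filter.Tendsto (fun z : Y × ℝ ↦ (z.1, z.2 - t₀)) (𝓝 (y₀, t₀)) (𝓝 (y₀, 0)) := by
    have : Continuous fun z : Y × ℝ ↦ (z.1, z.2 - t₀) := by fun_prop
    simpa using this.tendsto (y₀, t₀)
  have hnear := hh.continuousAt.eventually
    (by rw [hh0]; exact hfe.and (extChartAt_target_mem_nhds (I := I) (1 : G)))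
  filter_upwards [hshift.eventually (hh.eventually (by simp)), hshift.eventually hsol,
    hshift.eventually hnear] with z h1 h2 h3
  obtain ⟨y, t⟩ := z
  simp only [add_sub_cancel] at h2
  set u := h (y, t - t₀) with hu
  have hut : u ∈ φ.target := h3.2
  refine ⟨ContDiffAt.contMDiffAt_extChartAt_symm hnle (h1.comp (y, t)
    (contDiffAt_fst.prodMk (contDiffAt_snd.sub contDiffAt_const))) hut, ?_⟩
  refine HasLogDerivAt.comp_sub_const (g := fun t ↦ φ.symm (h (y, t))) ⟨?_, ?_⟩
  · exact ContinuousAt.comp (f := fun t ↦ h (y, t)) (g := φ.symm)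
      (continuousAt_extChartAt_symm'' hut) h2.continuousAt
  simp only [← hu]
  set p := φ.symm u with hp
  obtain ⟨h4, h5⟩ := h3.1 (ξ (y, t))
  have hΨ : ContMDiffAt 𝓘(ℝ, E) I ∞ (fun v ↦ p⁻¹ * φ.symm v) u :=
    contMDiffAt_const.mul (ContDiffAt.contMDiffAt_extChartAt_symm le_rfl contDiffAt_id hut)
  have hd := (hΨ.contDiffAt_extChartAt le_rfl (by
    simp only [← hp, inv_mul_cancel]
    exact mem_extChartAt_source (I := I) (1 : G))).differentiableAt (by simp) |>.hasFDerivAt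
  set D := fderiv ℝ (fun v ↦ φ (p⁻¹ * φ.symm v)) u
  have hpu : φ (p * φ.symm e) = u := by rw [hφ1, mul_one]; exact φ.right_inv hut
  have hcomp := HasFDerivAt.comp e (g := fun v ↦ φ (p⁻¹ * φ.symm v))
    (f := fun v ↦ φ (p * φ.symm v)) (by rw [hpu]; exact hd) h4
  -- Translation by `p⁻¹` undoes translation by `p`, so `D` inverts the derivative that defines `f
  -- (u, ·)`.
  have hid : (fun v ↦ φ (p⁻¹ * φ.symm v)) ∘ (fun v ↦ φ (p * φ.symm v)) =ᶠ[𝓝 e] id := by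
    have hps : p * φ.symm e ∈ φ.source := by
      rw [hφ1, mul_one]
      exact φ.map_target hut
    have : ∀ᶠ v in 𝓝 e, p * φ.symm v ∈ φ.source :=
      (continuousAt_const.mul (continuousAt_extChartAt_symm (I := I) (1 : G))).eventually_mem
        ((isOpen_extChartAt_source (I := I) (1 : G)).mem_nhds hps)
    filter_upwards [this, extChartAt_target_mem_nhds (I := I) (1 : G)] with v hv hv'
    simp [φ.left_inv hv, φ.right_inv hv']
  have hDw : D (f (u, ξ (y, t))) = ξ (y, t) := by
    rw [← h5]
    exact DFunLike.congr_fun (hcomp.unique ((hasFDerivAt_id e).congr_of_eventuallyEq hid)) _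
  have := HasFDerivAt.comp_hasDerivAt (t - t₀) (by rw [← hu]; exact hd) h2
  rw [hDw] at this
  exact this

end LocalSolution

/-! ### Global solutions and their smooth dependence on parameters. -/

section GlobalSolution

variable {E H : Type*} [NormedAddCommGroup E] [NormedSpace ℝ E] [FiniteDimensional ℝ E]
  [TopologicalSpace H]
  {I : ModelWithCorners ℝ E H} [I.Boundaryless] {G : Type*} [TopologicalSpace G] [ChartedSpace H G]
  [Group G] [LieGroup I ∞ G]

theorem exists_solution_Icc {ξ : ℝ → E} (hξ : ContDiff ℝ ∞ ξ) {a b : ℝ} (hab : a ≤ b) :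
    ∃ g : ℝ → G, ∀ t ∈ Set.Icc a b, HasLogDerivAt I g (ξ t) t := by
  have hloc : ∀ t₀ : ℝ, ∃ (s : Set ℝ) (k : ℝ → G), IsOpen s ∧ t₀ ∈ s ∧
      ∀ t ∈ s, HasLogDerivAt I k (ξ t) t := by
    intro t₀
    -- There is no parameter here: `ℝ` serves as a dummy parameter space, evaluated at `0`.
    obtain ⟨k, hk⟩ := exists_local_solution (I := I) (G := G) 1 one_ne_zero
      (fun z : ℝ × ℝ ↦ ξ z.2) (hξ.comp contDiff_snd) 0 t₀
    have h1 : ∀ᶠ t in 𝓝 t₀, HasLogDerivAt I (fun t ↦ k (0, t)) (ξ t) t := by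
      have h2 : Continuous fun t : ℝ ↦ ((0 : ℝ), t) := by fun_prop
      filter_upwards [h2.continuousAt.eventually hk] with t ht using ht.2
    obtain ⟨s, hs, hso, hts⟩ := eventually_nhds_iff.1 h1
    exact ⟨s, _, hso, hts, hs⟩
  choose s k hso hmem hk using hloc
  obtain ⟨t, ht0, htm, ⟨m, hm⟩, hts⟩ := exists_monotone_Icc_subset_open_cover_Icc hab
    (c := fun i ↦ ((↑) : Set.Icc a b → ℝ) ⁻¹' s i) (fun i ↦ (hso i).preimage continuous_subtype_val)
    (fun x _ ↦ Set.mem_iUnion.2 ⟨x, hmem x⟩)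
  have hts' : ∀ n, ∃ i, Set.Icc (t n : ℝ) (t (n + 1)) ⊆ s i := fun n ↦ by
    obtain ⟨i, hi⟩ := hts n
    exact ⟨i, fun x hx ↦ hi (a := ⟨x, (t n).2.1.trans hx.1, hx.2.trans (t (n + 1)).2.2⟩) hx⟩
  have key : ∀ n, ∃ g : ℝ → G, ∀ x ∈ Set.Icc (t 0 : ℝ) (t n), HasLogDerivAt I g (ξ x) x := by
    intro n
    induction n with
    | zero =>
      obtain ⟨i, hi⟩ := hts' 0
      exact ⟨k i, fun x hx ↦ hk i x (hi ⟨hx.1, hx.2.trans (htm (Nat.zero_le _))⟩)⟩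
    | succ n ih =>
      obtain ⟨g, hg⟩ := ih
      obtain ⟨i, hi⟩ := hts' n
      exact HasLogDerivAt.exists_extension (htm (Nat.zero_le _)) hg
        (fun x hx ↦ hk i x (hi hx)) (htm n.le_succ)
  obtain ⟨g, hg⟩ := key m
  refine ⟨g, fun x hx ↦ hg x ?_⟩
  rwa [ht0, hm m le_rfl]

theorem exists_solution {ξ : ℝ → E} (hξ : ContDiff ℝ ∞ ξ) :
    ∃ g : ℝ → G, g 0 = 1 ∧ ∀ t, HasLogDerivAt I g (ξ t) t := by
  have h : ∀ n : ℕ, ∃ g : ℝ → G, g 0 = 1 ∧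
      ∀ t ∈ Set.Ioo (-(n : ℝ)) n, HasLogDerivAt I g (ξ t) t := by
    intro n
    obtain ⟨g, hg⟩ := exists_solution_Icc (I := I) (G := G) hξ (a := -(n : ℝ)) (b := n)
      (by linarith [Nat.cast_nonneg (α := ℝ) n])
    exact ⟨fun t ↦ (g 0)⁻¹ * g t, by simp, fun t ht ↦
      (hg t (Set.Ioo_subset_Icc_self ht)).const_mul _⟩
  choose g hg0 hg using h
  have hcomp : ∀ m n : ℕ, m ≤ n → ∀ t ∈ Set.Ioo (-(m : ℝ)) m, g n t = g m t := by
    intro m n hmn t ht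
    have hm : (0 : ℝ) < m := by linarith [ht.1, ht.2]
    have hmn' : (m : ℝ) ≤ n := by exact_mod_cast hmn
    have := HasLogDerivAt.mul_inv_eq isOpen_Ioo isPreconnected_Ioo
      (fun t ht ↦ hg n t ⟨by linarith [ht.1], by linarith [ht.2]⟩) (hg m)
      (a := 0) ⟨by linarith, hm⟩ ht
    simpa [hg0] using this
  have hmem : ∀ t : ℝ, t ∈ Set.Ioo (-((⌊|t|⌋₊ + 1 : ℕ) : ℝ)) (⌊|t|⌋₊ + 1 : ℕ) := fun t ↦
    abs_lt.1 (by exact_mod_cast Nat.lt_floor_add_one |t|)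
  -- The index exceeds `|t|`, so `t` is in the open interval where that solution is valid; by
  -- `hcomp` any larger index gives the same value.
  refine ⟨fun t ↦ g (⌊|t|⌋₊ + 1) t, hg0 _, fun t ↦ ?_⟩
  refine (hg _ t (hmem t)).congr_of_eventuallyEq ?_
  filter_upwards [isOpen_Ioo.mem_nhds (hmem t)] with τ hτ
  rcases le_total (⌊|t|⌋₊ + 1) (⌊|τ|⌋₊ + 1) with h | h
  · exact hcomp _ _ h τ hτ
  · exact (hcomp _ _ h τ (hmem τ)).symm

variable {Y : Type} [NormedAddCommGroup Y] [NormedSpace ℝ Y] [CompleteSpace Y]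

/-- Solutions of `g⁻¹ ∂g = ξ` depend smoothly on parameters. -/
theorem contMDiff_of_hasLogDerivAt {ξ : Y × ℝ → E} (hξ : ContDiff ℝ ∞ ξ) {g : Y × ℝ → G}
    (hg0 : ∀ y, g (y, 0) = 1)
    (hg : ∀ y t, HasLogDerivAt I (fun τ ↦ g (y, τ)) (ξ (y, t)) t) :
    ContMDiff 𝓘(ℝ, Y × ℝ) I ∞ g := by
  rw [contMDiff_infty]
  intro n
  have : LieGroup I (n + 1 : ℕ) G := LieGroup.of_le (n := ∞) (by exact_mod_cast le_top)
  -- The order is raised by one because the implicit function theorem needs order at least one.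
  suffices h : ContMDiff 𝓘(ℝ, Y × ℝ) I (n + 1 : ℕ) g from
    h.of_le (by exact_mod_cast n.le_succ)
  generalize hN : n + 1 = N at *
  have hN0 : N ≠ 0 := by omega
  rintro ⟨y₀, t₁⟩
  let S : Set ℝ := {t | ContMDiffAt 𝓘(ℝ, Y) I N (fun y ↦ g (y, t)) y₀}
  -- Near `t₀`, `g (y, t) = g (y, s) * (k (y, s))⁻¹ * k (y, t)` with a regular local solution `k`.
  -- So regularity at a single time `s` of the ball spreads to the whole ball, which makes `S` both
  -- open and closed.
  have key : ∀ t₀ : ℝ, ∃ δ > 0, ∀ s ∈ Metric.ball t₀ δ, s ∈ S → ∀ t ∈ Metric.ball t₀ δ,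
      ContMDiffAt 𝓘(ℝ, Y × ℝ) I N g (y₀, t) := by
    intro t₀
    obtain ⟨k, hk⟩ := exists_local_solution (I := I) (G := G) N hN0 ξ hξ y₀ t₀
    obtain ⟨δ, hδ, hball⟩ := Metric.eventually_nhds_iff_ball.1 hk
    rw [← ball_prod_same] at hball
    refine ⟨δ, hδ, fun s hs hsS t ht ↦ ?_⟩
    have hy : y₀ ∈ Metric.ball y₀ δ := Metric.mem_ball_self hδ
    have h1 : ContMDiffAt 𝓘(ℝ, Y × ℝ) I N (fun z : Y × ℝ ↦ g (z.1, s)) (y₀, t) :=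
      ContMDiffAt.comp (I' := 𝓘(ℝ, Y)) (y₀, t) (f := Prod.fst) hsS contDiffAt_fst.contMDiffAt
    have h2 : ContMDiffAt 𝓘(ℝ, Y × ℝ) I N (fun z : Y × ℝ ↦ k (z.1, s)) (y₀, t) :=
      ContMDiffAt.comp (I' := 𝓘(ℝ, Y × ℝ)) (y₀, t) (f := fun z : Y × ℝ ↦ (z.1, s))
        (hball (y₀, s) ⟨hy, hs⟩).1 (contDiffAt_fst.prodMk contDiffAt_const).contMDiffAt
    refine ((h1.mul h2.inv).mul (hball (y₀, t) ⟨hy, ht⟩).1).congr_of_eventuallyEq ?_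
    filter_upwards [(Metric.isOpen_ball.prod Metric.isOpen_ball).mem_nhds
      (Set.mk_mem_prod hy ht)] with z hz
    exact HasLogDerivAt.mul_inv_eq Metric.isOpen_ball (convex_ball t₀ δ).isPreconnected
      (fun τ _ ↦ hg z.1 τ) (fun τ hτ ↦ (hball (z.1, τ) ⟨hz.1, hτ⟩).2) hs hz.2
  have hslice : ∀ t, ContMDiffAt 𝓘(ℝ, Y × ℝ) I N g (y₀, t) → t ∈ S := fun t ht ↦
    ContMDiffAt.comp (I' := 𝓘(ℝ, Y × ℝ)) y₀ (f := fun y ↦ (y, t)) ht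
      (contDiffAt_id.prodMk contDiffAt_const).contMDiffAt
  have hS : IsClopen S := by
    constructor
    · rw [← isOpen_compl_iff, Metric.isOpen_iff]
      intro t₀ ht₀
      obtain ⟨δ, hδ, h⟩ := key t₀
      exact ⟨δ, hδ, fun s hs hsS ↦ ht₀ (hslice _ (h s hs hsS t₀ (Metric.mem_ball_self hδ)))⟩
    · rw [Metric.isOpen_iff]
      intro t₀ ht₀
      obtain ⟨δ, hδ, h⟩ := key t₀
      exact ⟨δ, hδ, fun s hs ↦ hslice _ (h t₀ (Metric.mem_ball_self hδ) ht₀ s hs)⟩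
  have hS' : S = Set.univ := hS.eq_univ ⟨0, by
    change ContMDiffAt 𝓘(ℝ, Y) I N (fun y ↦ g (y, 0)) y₀
    simp only [hg0]
    exact contMDiffAt_const⟩
  obtain ⟨δ, hδ, h⟩ := key t₁
  exact h t₁ (Metric.mem_ball_self hδ) (hS' ▸ Set.mem_univ _) t₁ (Metric.mem_ball_self hδ)

end GlobalSolution

/-! ### Fibres and local lifts in principal bundles. -/

section PrincipalBundle

variable {Γ : Type*} [Group Γ] [DiffeologicalSpace Γ] {P M : Type*} [DiffeologicalSpace P]
  [DiffeologicalSpace M] [MulAction Γᵐᵒᵖ P] {π : P → M}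

theorem IsPrincipalBundle.surjective (hπ : IsPrincipalBundle Γ π) : Function.Surjective π := by
  intro m
  obtain ⟨U, -, hm, e, -, -, he, -⟩ := hπ.locally_trivial m
  exact ⟨e (⟨m, hm⟩, 1), he _ _⟩

theorem IsPrincipalBundle.proj_smul (hπ : IsPrincipalBundle Γ π) (p : P) (γ : Γ) :
    π (p <• γ) = π p := by
  obtain ⟨U, -, hm, e, -, -, he, he'⟩ := hπ.locally_trivial (π p)
  obtain ⟨⟨u, δ⟩, hx⟩ := e.surjective ⟨p, hm⟩
  have h1 : (e (u, δ) : P) = p := congrArg Subtype.val hx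
  rw [← h1, ← he', he, he]

theorem IsPrincipalBundle.exists_eq_smul (hπ : IsPrincipalBundle Γ π) {p p' : P}
    (h : π p = π p') : ∃ γ : Γ, p' = p <• γ := by
  obtain ⟨U, -, hm, e, -, -, he, he'⟩ := hπ.locally_trivial (π p)
  obtain ⟨⟨u, δ⟩, hx⟩ := e.surjective ⟨p, hm⟩
  obtain ⟨⟨u', δ'⟩, hx'⟩ := e.surjective ⟨p', by rw [Set.mem_preimage, ← h]; exact hm⟩
  have h1 : (e (u, δ) : P) = p := congrArg Subtype.val hx
  have h2 : (e (u', δ') : P) = p' := congrArg Subtype.val hx'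
  have hu : u' = u := Subtype.ext (by rw [← he u δ, ← he u' δ', h1, h2, h])
  refine ⟨δ⁻¹ * δ', ?_⟩
  rw [← h1, ← h2, hu, ← he', mul_inv_cancel_left]

/-- Plots of the base lift locally to the total space. -/
theorem IsPrincipalBundle.exists_local_lift (hπ : IsPrincipalBundle Γ π) {n : ℕ}
    {c : EuclideanSpace ℝ (Fin n) → M} (hc : IsPlot c) (x : EuclideanSpace ℝ (Fin n)) :
    ∃ u : Set (EuclideanSpace ℝ (Fin n)), IsOpen u ∧ x ∈ u ∧
      ∀ {k : ℕ} {f : EuclideanSpace ℝ (Fin k) → EuclideanSpace ℝ (Fin n)}, (∀ y, f y ∈ u) →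
        ContDiff ℝ ∞ f → ∃ s : EuclideanSpace ℝ (Fin k) → P, IsPlot s ∧ ∀ y, π (s y) = c (f y) := by
  obtain ⟨U, hU, hm, e, he, -, he', -⟩ := hπ.locally_trivial (c x)
  refine ⟨c ⁻¹' U, isOpen_iff_preimages_plots.1 hU n c hc, hm, fun {k f} hf hf' ↦ ?_⟩
  -- The lift is the unit section of the trivialisation along `c ∘ f`.
  refine ⟨fun y ↦ e (⟨c (f y), hf y⟩, 1), ?_, fun y ↦ he' _ _⟩
  have h1 : IsPlot (fun y ↦ ((⟨c (f y), hf y⟩, 1) : U × Γ)) :=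
    ⟨isPlot_reparam hc hf', isPlot_const⟩
  exact he k _ h1

end PrincipalBundle

/-! ### Plots and the geometry of the path fibration. -/

section Plots

variable {E H : Type*} [NormedAddCommGroup E] [NormedSpace ℝ E] [TopologicalSpace H]
  {I : ModelWithCorners ℝ E H} {N : Type*} [TopologicalSpace N] [ChartedSpace H N]

theorem isPlot_manifoldDiffeology_iff {n : ℕ} {p : EuclideanSpace ℝ (Fin n) → N} :
    @IsPlot N (manifoldDiffeology I N) n p ↔
      ContMDiff 𝓘(ℝ, EuclideanSpace ℝ (Fin n)) I ∞ p :=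
  contMDiffOn_univ

theorem isPlot_functionalDiffeology_iff {X : Type*} {ev : X → ℝ → N}
    {hev : ∀ x, ContMDiff 𝓘(ℝ, ℝ) I ∞ (ev x)} {n : ℕ} {c : EuclideanSpace ℝ (Fin n) → X} :
    @IsPlot X (functionalDiffeology I ev hev) n c ↔
      ContMDiff 𝓘(ℝ, EuclideanSpace ℝ (Fin n) × ℝ) I ∞
        (fun z : EuclideanSpace ℝ (Fin n) × ℝ ↦ ev (c z.1) z.2) := by
  rw [modelWithCornersSelf_prod, ← chartedSpaceSelf_prod]
  change ContMDiffOn _ _ _ _ (Set.univ ×ˢ Set.univ) ↔ _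
  rw [Set.univ_prod_univ, contMDiffOn_univ]

end Plots

section PathSpace

variable {E H : Type*} [NormedAddCommGroup E] [NormedSpace ℝ E]
  [TopologicalSpace H] {I : ModelWithCorners ℝ E H} {G : Type*}
  [TopologicalSpace G] [ChartedSpace H G] [Group G]

theorem LoopAlgebra.isPlot_iff {n : ℕ} {c : EuclideanSpace ℝ (Fin n) → LoopAlgebra I G} :
    IsPlot c ↔ ContDiff ℝ ∞
      (fun z : EuclideanSpace ℝ (Fin n) × ℝ ↦ (show E from c z.1 z.2)) :=
  (isPlot_functionalDiffeology_iff (hev := fun ξ : LoopAlgebra I G ↦ ξ.smooth.contMDiff)).trans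
    contMDiff_iff_contDiff

theorem PathSpace.isPlot_iff {n : ℕ} {c : EuclideanSpace ℝ (Fin n) → PathSpace I G} :
    IsPlot c ↔ ContMDiff 𝓘(ℝ, EuclideanSpace ℝ (Fin n) × ℝ) I ∞
      (fun z : EuclideanSpace ℝ (Fin n) × ℝ ↦ c z.1 z.2) :=
  isPlot_functionalDiffeology_iff (hev := fun g : PathSpace I G ↦ g.smooth)

variable [LieGroup I ∞ G]

theorem LoopGroup.isPlot_iff {n : ℕ} {c : EuclideanSpace ℝ (Fin n) → LoopGroup I G} :
    IsPlot c ↔ ContMDiff 𝓘(ℝ, EuclideanSpace ℝ (Fin n) × ℝ) I ∞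
      (fun z : EuclideanSpace ℝ (Fin n) × ℝ ↦ c z.1 z.2) :=
  isPlot_functionalDiffeology_iff (hev := fun γ : LoopGroup I G ↦ γ.2.1)

theorem PathSpace.hasLogDerivAt (g : PathSpace I G) (t : ℝ) :
    HasLogDerivAt I g (leftLogDeriv I g t) t :=
  (g.smooth.mdifferentiable (by simp) t).hasLogDerivAt

theorem PathSpace.smul_apply (g : PathSpace I G) (γ : LoopGroup I G) (t : ℝ) :
    (g <• γ) t = g t * γ t := rfl

theorem LoopGroup.apply_two_pi (γ : LoopGroup I G) : γ (2 * Real.pi) = 1 := by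
  have h := γ.2.2.1 0
  rw [zero_add] at h
  exact h.trans γ.2.2.2

theorem pathFibration_smul (g : PathSpace I G) (γ : LoopGroup I G) :
    pathFibration I (g <• γ) = pathFibration I g := by
  rw [pathFibration, PathSpace.smul_apply, LoopGroup.apply_two_pi, mul_one, pathFibration]

variable [I.Boundaryless]

theorem PathSpace.eq_of_leftLogDeriv_eq {g k : PathSpace I G}
    (h : leftLogDeriv I g = leftLogDeriv I k) : g = k := by
  apply PathSpace.ext
  funext t
  have := HasLogDerivAt.mul_inv_eq isOpen_univ isPreconnected_univ
    (fun t _ ↦ g.hasLogDerivAt t) (fun t _ ↦ by rw [h]; exact k.hasLogDerivAt t)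
    (Set.mem_univ 0) (Set.mem_univ t)
  simpa [g.map_zero, k.map_zero] using this

/-- Both sides have the same logarithmic derivative, by periodicity, and agree at `t = 0`. Hence the
common factor cancels in `g⁻¹ k` when the endpoints agree, leaving a periodic curve. -/
theorem PathSpace.apply_add_two_pi (g : PathSpace I G) (t : ℝ) :
    g (t + 2 * Real.pi) = pathFibration I g * g t := by
  have := HasLogDerivAt.mul_inv_eq (g := fun t ↦ g (t + 2 * Real.pi)) isOpen_univ
    isPreconnected_univ (fun t _ ↦ HasLogDerivAt.comp_add_const (g.hasLogDerivAt _))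
    (fun t _ ↦ by rw [g.periodic]; exact g.hasLogDerivAt t) (Set.mem_univ 0) (Set.mem_univ t)
  simpa [g.map_zero, pathFibration] using this

/-- The loop `g⁻¹ k` for two paths in the same fibre of the path fibration. -/
noncomputable def PathSpace.invMul (g k : PathSpace I G)
    (h : pathFibration I g = pathFibration I k) : LoopGroup I G :=
  ⟨fun t ↦ (g t)⁻¹ * k t, g.smooth.inv.mul k.smooth,
    fun t ↦ by simp [PathSpace.apply_add_two_pi, h, mul_assoc], by simp [g.map_zero, k.map_zero]⟩

theorem PathSpace.smul_invMul (g k : PathSpace I G)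
    (h : pathFibration I g = pathFibration I k) : g <• g.invMul k h = k := by
  apply PathSpace.ext
  funext t
  exact mul_inv_cancel_left (g t) (k t)

theorem PathSpace.isPlot_invMul {n : ℕ} {c d : EuclideanSpace ℝ (Fin n) → PathSpace I G}
    (hc : IsPlot c) (hd : IsPlot d) (h : ∀ x, pathFibration I (c x) = pathFibration I (d x)) :
    IsPlot (fun x ↦ (c x).invMul (d x) (h x)) :=
  LoopGroup.isPlot_iff.2 ((PathSpace.isPlot_iff.1 hc).inv.mul (PathSpace.isPlot_iff.1 hd))

variable [FiniteDimensional ℝ E]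

/-- The development of a periodic curve in the Lie algebra. -/
theorem LoopAlgebra.exists_path (ξ : LoopAlgebra I G) :
    ∃ g : PathSpace I G, leftLogDeriv I g = ξ := by
  obtain ⟨g, hg0, hg⟩ := exists_solution (I := I) (G := G) ξ.smooth
  have hsm : ContMDiff 𝓘(ℝ, ℝ) I ∞ g := by
    have h := contMDiff_of_hasLogDerivAt (I := I) (g := fun z : ℝ × ℝ ↦ g z.2)
      (ξ.smooth.comp contDiff_snd) (fun _ ↦ hg0) (fun _ t ↦ hg t)
    exact h.comp (g := fun z : ℝ × ℝ ↦ g z.2) (f := fun t : ℝ ↦ ((0 : ℝ), t))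
      (contDiff_const.prodMk contDiff_id).contMDiff
  have hξ : leftLogDeriv I g = ξ := funext fun t ↦
    ((hsm.mdifferentiable (by simp) t).hasLogDerivAt).unique (hg t)
  exact ⟨⟨g, hsm, hg0, by rw [hξ]; exact ξ.periodic⟩, hξ⟩

/-- A family of paths is smooth if the family of their logarithmic derivatives is. -/
theorem PathSpace.isPlot_of_leftLogDeriv {n : ℕ} {c : EuclideanSpace ℝ (Fin n) → PathSpace I G}
    {ξ : EuclideanSpace ℝ (Fin n) → LoopAlgebra I G} (hξ : IsPlot ξ)
    (h : ∀ x, leftLogDeriv I (c x) = ξ x) : IsPlot c := by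
  refine PathSpace.isPlot_iff.2 ?_
  refine contMDiff_of_hasLogDerivAt (I := I)
    (g := fun z : EuclideanSpace ℝ (Fin n) × ℝ ↦ c z.1 z.2)
    (LoopAlgebra.isPlot_iff.1 hξ) (fun y ↦ (c y).map_zero) (fun y t ↦ ?_)
  rw [← h y]
  exact (c y).hasLogDerivAt t

end PathSpace

/-! ### From equivariant maps into the path space to pullback bundles. -/

section EquivariantMap

variable {E H : Type*} [NormedAddCommGroup E] [NormedSpace ℝ E]
  [TopologicalSpace H] {I : ModelWithCorners ℝ E H} {G : Type*}
  [TopologicalSpace G] [ChartedSpace H G] [Group G] [LieGroup I ∞ G]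
  {P M : Type*} [DiffeologicalSpace P] [DiffeologicalSpace M] [MulAction (LoopGroup I G)ᵐᵒᵖ P]
  {π : P → M}

/-- Along a local lift of a plot, `f` is the value at `2π` of a smooth family of paths. -/
theorem dSmooth_of_lift (hπ : IsPrincipalBundle (LoopGroup I G) π) {hol : P → PathSpace I G}
    (hs : DSmooth hol) {f : M → G} (hf : ∀ p, f (π p) = pathFibration I (hol p)) :
    @DSmooth M G _ (manifoldDiffeology I G) f := by
  let _ : DiffeologicalSpace G := manifoldDiffeology I G
  intro n c hc
  refine DiffeologicalSpace.locality fun x ↦ ?_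
  obtain ⟨u, hu, hx, h⟩ := hπ.exists_local_lift hc x
  refine ⟨u, hu, hx, fun {m k} hk hk' ↦ ?_⟩
  obtain ⟨s, hs', hsπ⟩ := h hk hk'
  have h1 := PathSpace.isPlot_iff.1 (hs m s hs')
  refine isPlot_manifoldDiffeology_iff.2 ?_
  have h2 : (f ∘ c) ∘ k = fun y ↦ hol (s y) (2 * Real.pi) := by
    funext y
    simp [← hsπ, hf, pathFibration]
  rw [h2]
  exact h1.comp (f := fun y ↦ (y, 2 * Real.pi)) (contDiff_id.prodMk contDiff_const).contMDiff

variable [I.Boundaryless]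

/-- A bundle with a smooth equivariant map to the path space is a pullback of the path
fibration. -/
theorem isPullbackBundle_of_equivariant (hπ : IsPrincipalBundle (LoopGroup I G) π)
    {hol : P → PathSpace I G} (hs : DSmooth hol)
    (heq : ∀ (p : P) (γ : LoopGroup I G), hol (p <• γ) = hol p <• γ) {f : M → G}
    (hf : ∀ p, f (π p) = pathFibration I (hol p)) :
    IsPullbackBundle (LoopGroup I G) π (pathFibration I (G := G)) f := by
  let e₀ : P → {x : M × PathSpace I G // f x.1 = pathFibration I x.2} :=
    fun p ↦ ⟨(π p, hol p), hf p⟩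
  have hinj : Function.Injective e₀ := by
    intro p p' h
    have h1 : π p = π p' := congrArg (fun x ↦ x.1.1) h
    have h2 : hol p = hol p' := congrArg (fun x ↦ x.1.2) h
    obtain ⟨γ, rfl⟩ := hπ.exists_eq_smul h1
    have h3 : γ = 1 := by
      refine Subtype.ext (funext fun t ↦ ?_)
      have := congrArg (fun g : PathSpace I G ↦ g t) h2
      simp only [heq, PathSpace.smul_apply] at this
      exact left_eq_mul.1 this
    rw [h3, MulOpposite.op_one, one_smul]
  -- Any point `p` of the right fibre is corrected by the loop `(hol p)⁻¹ q`. The formula yields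
  -- surjectivity here and smoothness of the inverse below.
  have hlift : ∀ (x : {x : M × PathSpace I G // f x.1 = pathFibration I x.2}) (p : P)
      (hp : π p = x.1.1), ∃ h : pathFibration I (hol p) = pathFibration I x.1.2,
        e₀ (p <• (hol p).invMul x.1.2 h) = x := by
    rintro ⟨⟨m, q⟩, hx⟩ p rfl
    refine ⟨(hf p).symm.trans hx, Subtype.ext (Prod.ext (hπ.proj_smul _ _) ?_)⟩
    simp only [e₀, heq, PathSpace.smul_invMul]
  have hsurj : Function.Surjective e₀ := by
    intro x
    obtain ⟨p, hp⟩ := hπ.surjective x.1.1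
    exact ⟨_, (hlift x p hp).2⟩
  refine ⟨Equiv.ofBijective e₀ ⟨hinj, hsurj⟩, ?_, ?_, fun p ↦ rfl, fun p γ ↦ heq p γ⟩
  · exact fun n c hc ↦ ⟨hπ.smooth_proj n c hc, hs n c hc⟩
  · intro n c hc
    refine DiffeologicalSpace.locality fun x ↦ ?_
    obtain ⟨u, hu, hx, h⟩ := hπ.exists_local_lift hc.1 x
    refine ⟨u, hu, hx, fun {m k} hk hk' ↦ ?_⟩
    obtain ⟨s, hs', hsπ⟩ := h hk hk'
    have hfib := fun y ↦ (hlift (c (k y)) (s y) (hsπ y)).1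
    have h1 : ((Equiv.ofBijective e₀ ⟨hinj, hsurj⟩).symm ∘ c) ∘ k =
        fun y ↦ s y <• (hol (s y)).invMul (c (k y)).1.2 (hfib y) := by
      funext y
      exact (Equiv.symm_apply_eq _).2 (hlift (c (k y)) (s y) (hsπ y)).2.symm
    rw [h1]
    exact hπ.smooth_act m (fun y ↦ (s y, (hol (s y)).invMul (c (k y)).1.2 (hfib y)))
      ⟨hs', PathSpace.isPlot_invMul (hs m s hs') (isPlot_reparam hc.2 hk') hfib⟩

end EquivariantMap

theorem mainTheorem5 {E H G : Type*} [NormedAddCommGroup E] [NormedSpace ℝ E]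
    [FiniteDimensional ℝ E] [TopologicalSpace H] (I : ModelWithCorners ℝ E H) [I.Boundaryless]
    [TopologicalSpace G] [ChartedSpace H G] [Group G] [LieGroup I ∞ G]
    [T2Space G] [CompactSpace G] [ConnectedSpace G]
    {P M : Type*} [DiffeologicalSpace P] [DiffeologicalSpace M]
    [MulAction (LoopGroup I G)ᵐᵒᵖ P]
    (π : P → M) (hπ : IsPrincipalBundle (LoopGroup I G) π) (Φ : HiggsField I G P) :
    (∀ p : P, ∃! g : PathSpace I G, leftLogDeriv I g = Φ p) ∧
    ∃ (hol : P → PathSpace I G) (holM : M → G),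
      (∀ p : P, leftLogDeriv I (hol p) = Φ p) ∧
      DSmooth hol ∧
      (∀ (p : P) (γ : LoopGroup I G), hol (p <• γ) = hol p <• γ) ∧
      (∀ p : P, holM (π p) = pathFibration I (hol p)) ∧
      IsClassifyingMap I π holM := by
  choose hol hhol using fun p ↦ (Φ p).exists_path
  have hsmooth : DSmooth hol := fun n c hc ↦
    PathSpace.isPlot_of_leftLogDeriv (Φ.smooth n c hc) fun x ↦ hhol (c x)
  -- Both sides are paths with logarithmic derivative `Φ (p γ)`: the transformation law of `Φ`
  -- matches the product rule.
  have heq : ∀ (p : P) (γ : LoopGroup I G), hol (p <• γ) = hol p <• γ := by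
    refine fun p γ ↦ PathSpace.eq_of_leftLogDeriv_eq (funext fun t ↦ ?_)
    rw [hhol, Φ.equivariant, ← hhol]
    exact (leftLogDeriv_mul I (hol p).smooth γ.2.1 t).symm
  -- The endpoint does not depend on the chosen point of the fibre, because loops take the value `1`
  -- at `2π`.
  have hholM : ∀ p : P, pathFibration I (hol (Function.surjInv hπ.surjective (π p))) =
      pathFibration I (hol p) := by
    intro p
    obtain ⟨γ, hγ⟩ := hπ.exists_eq_smul (Function.surjInv_eq hπ.surjective (π p)).symm
    rw [hγ, heq, pathFibration_smul]
  exact ⟨fun p ↦ ⟨hol p, hhol p, fun g hg ↦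
      PathSpace.eq_of_leftLogDeriv_eq (hg.trans (hhol p).symm)⟩,
    hol, fun m ↦ pathFibration I (hol (Function.surjInv hπ.surjective m)), hhol, hsmooth, heq,
    hholM, dSmooth_of_lift hπ hsmooth hholM, isPullbackBundle_of_equivariant hπ hsmooth heq hholM⟩
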